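/- Let $(X_n)_{n\ge 1}$ be independent standard Gaussian random variables (mean $0$, variance $1$) on a probability space, and let $F(\sigma)=\sum_{n=1}^{\infty} X_n n^{-\sigma}$, which almost surely converges for every real $\sigma>1/2$. For $T>1/2$ let $N(T,\infty)$ be the number of real zeros of $F$ in $[T,\infty)$, each zero counted without multiplicity. There exist $\delta>0$ and real constants $c_0$, $(c_n)_{n\ge 2}$ such that, for all $T\in(1/2,1/2+\delta)$, the expectation $\mathbb{E}\,N(T,\infty)$ is finite and $$\mathbb{E}\,N(T,\infty)=\frac{1}{2\pi}\log\left(\frac{1}{T-1/2}\right)+c_0+\sum_{n=2}^{\infty}c_n\,(T-1/2)^n,$$ where the power series converges for every such $T$. The constants $\delta$, $c_0$, $c_n$ are absolute: they depend neither on $T$ nor on the choice of the probability space and of the variables $X_n$. -/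

import Mathlib

open MeasureTheory ProbabilityTheory Filter Topology

noncomputable section

/-- The `N`-th partial sum of the Dirichlet series `∑_{n ≥ 1} x_n n^{-σ}`. The coefficients are
indexed from `0`: the entry `x n` is the coefficient of `(n + 1)^{-σ}`. -/
def dirichletPartialSum (x : ℕ → ℝ) (σ : ℝ) (N : ℕ) : ℝ :=
  ∑ n ∈ Finset.range N, x n * ((n : ℝ) + 1) ^ (-σ)

/-- The real zeros in `[T, ∞)` of the Dirichlet series `F(σ) = ∑_{n ≥ 1} x_n n^{-σ}`: the points
`σ ≥ T` at which the series converges, as the limit of its partial sums (the convergence need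
not be absolute), and has sum `0`. -/
def realZerosFrom (x : ℕ → ℝ) (T : ℝ) : Set ℝ :=
  {σ : ℝ | T ≤ σ ∧ Tendsto (dirichletPartialSum x σ) atTop (𝓝 0)}

/-- `N(T, ∞)`: the number, possibly infinite, of real zeros in `[T, ∞)` of the random Dirichlet
series with coefficients `X n ω`, each zero being counted once. -/
def zeroCount {Ω : Type*} (X : ℕ → Ω → ℝ) (T : ℝ) (ω : Ω) : ENNReal :=
  ((realZerosFrom (fun n => X n ω) T).encard : ENNReal)

end

/-! The vectors (n^{-σ})_n in ℓ², once normalised, trace a curve on the unit sphere, and a zero of F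
is a crossing of this curve with a random hyperplane. Two values F(s), F(t) are jointly Gaussian
with correlation ρ = ζ(s+t)/√(ζ(2s)ζ(2t)), so by Sheppard's formula they have opposite signs with
probability arccos(ρ)/π. Since log ρ is minus half a second difference of log ζ, arccos(ρ) is to
first order (t−s)√((log ζ)''(2σ)). Summing over a fine grid gives a Riemann sum, hence the Kac–Rice
formula E N(T,∞) = (1/π)∫_T^∞ √((log ζ)''(2σ)) dσ (`lintegral_encard_realZerosFrom`).

Grid sign changes never outnumber zeros. Conversely, almost surely no zero is double
(`ae_no_double_zero`) and no grid point is a zero, so every finite set of zeros is eventually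
detected; Fatou's lemma then gives the other inequality. This needs one almost sure event on which F
is smooth on the whole half-line: the partial sums of X are O(N^{1/2+ε}) (`ae_sqrtGrowth`), and
partial summation makes F holomorphic on re s > 1/2.

The simple pole of ζ gives (log ζ)''(1+x) = 1/x² + h(x) with h analytic at 0. The integrand at 1/2+y
is therefore 1/(2y) + y q(y) with q analytic (`exists_zeroSpeed_expansion`). Integration produces
the logarithm, a constant, and powers from the second on: there is no linear term because the
integrand has no constant term. -/

noncomputable section

/-! ### The second logarithmic derivative of ζ on the half-line u > 1 -/

/-- The Riemann zeta function on the real half-line `u > 1`, as a real series. -/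
def zetaReal (u : ℝ) : ℝ := ∑' n : ℕ, ((n : ℝ) + 1) ^ (-u)

/-- The second logarithmic derivative of the zeta function, at real arguments. -/
def logZetaDeriv2 (u : ℝ) : ℝ :=
  (LSeries (LSeries.logMul fun n => (ArithmeticFunction.vonMangoldt n : ℂ)) u).re

lemma summable_zetaReal {u : ℝ} (hu : 1 < u) : Summable fun n : ℕ => ((n : ℝ) + 1) ^ (-u) := by
  have h := (summable_nat_add_iff 1).mpr (Real.summable_nat_rpow (p := -u) |>.mpr (by linarith))
  simpa using h

lemma one_le_zetaReal {u : ℝ} (hu : 1 < u) : 1 ≤ zetaReal u := by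
  have h := (summable_zetaReal hu).le_tsum 0 (fun n _ => by positivity)
  simpa [zetaReal] using h

lemma zetaReal_pos {u : ℝ} (hu : 1 < u) : 0 < zetaReal u :=
  lt_of_lt_of_le one_pos (one_le_zetaReal hu)

lemma riemannZeta_ofReal {u : ℝ} (hu : 1 < u) : riemannZeta u = (zetaReal u : ℂ) := by
  rw [zeta_eq_tsum_one_div_nat_add_one_cpow (by simpa using hu), zetaReal, Complex.ofReal_tsum]
  refine tsum_congr fun n => ?_
  rw [Complex.ofReal_cpow (by positivity), Complex.ofReal_neg, Complex.cpow_neg, one_div]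
  push_cast
  rfl

lemma abscissa_vonMangoldt_lt {s : ℂ} (hs : 1 < s.re) :
    LSeries.abscissaOfAbsConv (fun n => (ArithmeticFunction.vonMangoldt n : ℂ)) < s.re := by
  refine lt_of_le_of_lt (LSeries.abscissaOfAbsConv_le_of_forall_lt_LSeriesSummable (x := 1) ?_)
    (by exact_mod_cast hs)
  intro y hy
  exact ArithmeticFunction.LSeriesSummable_vonMangoldt (by simpa using hy)

lemma hasDerivAt_log_zetaReal {u : ℝ} (hu : 1 < u) :
    HasDerivAt (fun y => Real.log (zetaReal y))
      (-(LSeries (fun n => (ArithmeticFunction.vonMangoldt n : ℂ)) u).re) u := by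
  have h1 : HasDerivAt riemannZeta (deriv riemannZeta u) (u : ℂ) :=
    (differentiableAt_riemannZeta (by exact_mod_cast hu.ne')).hasDerivAt
  have h2 : HasDerivAt zetaReal (deriv riemannZeta u).re u := by
    refine h1.real_of_complex.congr_of_eventuallyEq ?_
    filter_upwards [lt_mem_nhds hu] with y hy
    rw [riemannZeta_ofReal hy, Complex.ofReal_re]
  convert h2.log (zetaReal_pos hu).ne' using 1
  rw [ArithmeticFunction.LSeries_vonMangoldt_eq_deriv_riemannZeta_div (by simpa using hu),
    riemannZeta_ofReal hu, neg_div, Complex.neg_re, Complex.div_ofReal_re, neg_neg]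

lemma hasDerivAt_LSeries_vonMangoldt {u : ℝ} (hu : 1 < u) :
    HasDerivAt (fun y : ℝ => -(LSeries (fun n => (ArithmeticFunction.vonMangoldt n : ℂ)) y).re)
      (logZetaDeriv2 u) u := by
  have h := (LSeries_hasDerivAt (abscissa_vonMangoldt_lt (s := u) (by simpa using hu)))
  simpa [logZetaDeriv2] using h.real_of_complex.fun_neg

lemma continuousOn_logZetaDeriv2 : ContinuousOn logZetaDeriv2 (Set.Ioi 1) := by
  intro u hu
  have h := LSeries_hasDerivAt (f := LSeries.logMul fun n => (ArithmeticFunction.vonMangoldt n : ℂ))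
    (s := u) (by rw [LSeries.abscissaOfAbsConv_logMul];
                 exact abscissa_vonMangoldt_lt (by simpa using hu))
  exact h.real_of_complex.continuousAt.continuousWithinAt

lemma hasSum_logZetaDeriv2 {u : ℝ} (hu : 1 < u) :
    HasSum (fun n : ℕ => Real.log n * ArithmeticFunction.vonMangoldt n * (n : ℝ) ^ (-u))
      (logZetaDeriv2 u) := by
  have h : LSeriesSummable (LSeries.logMul fun n => (ArithmeticFunction.vonMangoldt n : ℂ)) u :=
    LSeriesSummable_logMul_of_lt_re (abscissa_vonMangoldt_lt (by simpa using hu))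
  have h2 := Complex.hasSum_re h.LSeriesHasSum
  refine h2.congr_fun fun n => ?_
  rcases eq_or_ne n 0 with rfl | hn
  · simp
  · rw [LSeries.term_of_ne_zero hn, LSeries.logMul, ← Complex.natCast_log, Real.rpow_neg (by positivity),
      ← div_eq_mul_inv, ← Complex.ofReal_natCast, ← Complex.ofReal_cpow (by positivity)]
    norm_cast

lemma logZetaDeriv2_nonneg {u : ℝ} (hu : 1 < u) : 0 ≤ logZetaDeriv2 u := by
  rw [← (hasSum_logZetaDeriv2 hu).tsum_eq]
  exact tsum_nonneg fun n => mul_nonneg (mul_nonneg (Real.log_natCast_nonneg n)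
    ArithmeticFunction.vonMangoldt_nonneg) (by positivity)

/-- The Dirichlet series has nonnegative terms supported on n ≥ 2, and each such term gains a factor
n^{3-u} ≤ 2^{3-u}. This exponential decay makes the Kac–Rice integral converge at infinity. -/
lemma logZetaDeriv2_le {u : ℝ} (hu : 3 ≤ u) :
    logZetaDeriv2 u ≤ 2 ^ (3 - u) * logZetaDeriv2 3 := by
  refine hasSum_le ?_ (hasSum_logZetaDeriv2 (u := u) (by linarith))
    ((hasSum_logZetaDeriv2 (u := 3) (by norm_num)).mul_left _)
  intro n
  rcases Nat.lt_or_ge n 2 with hn | hn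
  · interval_cases n <;> simp
  · have hn' : (2 : ℝ) ≤ n := by exact_mod_cast hn
    have h1 : (n : ℝ) ^ (-u) = (n : ℝ) ^ (3 - u) * (n : ℝ) ^ (-3 : ℝ) := by
      rw [← Real.rpow_add (by linarith)]; congr 1; ring
    have h2 : (n : ℝ) ^ (3 - u) ≤ 2 ^ (3 - u) :=
      Real.rpow_le_rpow_of_nonpos (by norm_num) hn' (by linarith)
    rw [h1]
    have h3 : 0 ≤ Real.log n * ArithmeticFunction.vonMangoldt n :=
      mul_nonneg (Real.log_natCast_nonneg n) ArithmeticFunction.vonMangoldt_nonneg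
    have h4 : (0:ℝ) ≤ (n : ℝ) ^ (-3 : ℝ) := by positivity
    calc _ = (Real.log n * ArithmeticFunction.vonMangoldt n) * (n : ℝ) ^ (-3 : ℝ) *
          (n : ℝ) ^ (3 - u) := by ring
      _ ≤ (Real.log n * ArithmeticFunction.vonMangoldt n) * (n : ℝ) ^ (-3 : ℝ) * 2 ^ (3 - u) := by
          gcongr
      _ = _ := by ring

/-- The function Z(s) = (s−1)ζ(s) extends holomorphically to s = 1 with value 1, so D = Z'/Z is
analytic there and −ζ'/ζ = 1/(s−1) − D. One more derivative gives the double pole with no 1/x term.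
-/
lemma exists_analyticAt_logZetaDeriv2 :
    ∃ h : ℝ → ℝ, AnalyticAt ℝ h 0 ∧
      ∀ᶠ x in 𝓝[>] (0 : ℝ), logZetaDeriv2 (1 + x) = 1 / x ^ 2 + h x := by
  let Z : ℂ → ℂ := Function.update (fun s => (s - 1) * riemannZeta s) 1 1
  have hZe : ∀ s, s ≠ 1 → Z s = (s - 1) * riemannZeta s := fun s hs => by
    simp [Z, Function.update_of_ne hs]
  have hZ : AnalyticAt ℂ Z 1 := by
    refine Complex.analyticAt_of_differentiable_on_punctured_nhds_of_continuousAt ?_ ?_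
    · filter_upwards [self_mem_nhdsWithin] with s hs
      have : DifferentiableAt ℂ (fun s => (s - 1) * riemannZeta s) s :=
        (by fun_prop : DifferentiableAt ℂ (fun s : ℂ => s - 1) s).mul
          (differentiableAt_riemannZeta hs)
      refine this.congr_of_eventuallyEq ?_
      filter_upwards [isOpen_ne.mem_nhds hs] with y hy using hZe y hy
    · rw [continuousAt_update_same]
      exact riemannZeta_residue_one
  have hZ1 : Z 1 = 1 := by simp [Z]
  let D : ℂ → ℂ := fun s => deriv Z s / Z s
  have hD : AnalyticAt ℂ D 1 := hZ.deriv.div hZ (by simp [hZ1])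
  have hΛ : ∀ s : ℂ, 1 < s.re → LSeries (fun n => (ArithmeticFunction.vonMangoldt n : ℂ)) s
      = 1 / (s - 1) - D s := by
    intro s hs
    have hs1 : s ≠ 1 := by rintro rfl; simp at hs
    have hs1' : s - 1 ≠ 0 := sub_ne_zero.mpr hs1
    have hd : deriv Z s = riemannZeta s + (s - 1) * deriv riemannZeta s := by
      have h : HasDerivAt (fun s => (s - 1) * riemannZeta s)
          (1 * riemannZeta s + (s - 1) * deriv riemannZeta s) s :=
        ((hasDerivAt_id s).sub_const 1).mul (differentiableAt_riemannZeta hs1).hasDerivAt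
      rw [one_mul] at h
      refine (h.congr_of_eventuallyEq ?_).deriv
      filter_upwards [isOpen_ne.mem_nhds hs1] with y hy using hZe y hy
    have hne := riemannZeta_ne_zero_of_one_lt_re hs
    rw [ArithmeticFunction.LSeries_vonMangoldt_eq_deriv_riemannZeta_div hs]
    simp only [D, hd, hZe s hs1]
    field_simp
    ring
  have hΛ2 : ∀ s : ℂ, 1 < s.re → DifferentiableAt ℂ D s →
      LSeries (LSeries.logMul fun n => (ArithmeticFunction.vonMangoldt n : ℂ)) s
      = 1 / (s - 1) ^ 2 + deriv D s := by
    intro s hs hDs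
    have hs1 : s ≠ 1 := by rintro rfl; simp at hs
    have hs1' : s - 1 ≠ 0 := sub_ne_zero.mpr hs1
    have h1 := LSeries_hasDerivAt (abscissa_vonMangoldt_lt hs)
    have h2 : HasDerivAt (fun s => 1 / (s - 1) - D s) (-1 / (s - 1) ^ 2 - deriv D s) s := by
      refine HasDerivAt.sub ?_ hDs.hasDerivAt
      simpa using ((hasDerivAt_id s).sub_const 1).fun_inv hs1'
    have h3 := h1.unique (h2.congr_of_eventuallyEq (by
      filter_upwards [(isOpen_lt continuous_const Complex.continuous_re).mem_nhds hs] with y hy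
        using hΛ y hy))
    rw [← neg_neg (LSeries _ s), h3]
    ring
  refine ⟨fun x => (deriv D (1 + x)).re, ?_, ?_⟩
  · have h1 : AnalyticAt ℂ (fun z => deriv D (1 + z)) ((0 : ℝ) : ℂ) := by
      refine AnalyticAt.fun_comp (g := deriv D) (f := fun z : ℂ => 1 + z) ?_ (by fun_prop)
      simpa using hD.deriv
    exact h1.re_ofReal
  · have h1 : ∀ᶠ x : ℝ in 𝓝 0, DifferentiableAt ℂ D (1 + x) := by
      have h2 : ∀ᶠ s in 𝓝 (1 : ℂ), DifferentiableAt ℂ D s :=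
        hD.eventually_analyticAt.mono fun s hs => hs.differentiableAt
      have h3 : Tendsto (fun x : ℝ => (1 : ℂ) + x) (𝓝 0) (𝓝 1) := by
        have : Continuous (fun x : ℝ => (1 : ℂ) + x) := by fun_prop
        simpa using this.tendsto 0
      exact h3.eventually h2
    filter_upwards [nhdsWithin_le_nhds h1, self_mem_nhdsWithin] with x hx hx0
    have hx0' : (0:ℝ) < x := hx0
    rw [logZetaDeriv2]
    push_cast
    rw [hΛ2 _ (by simpa using hx0') hx, Complex.add_re]
    congr 1
    rw [add_sub_cancel_left]
    norm_cast

/-! ### The Kac–Rice density, its integrability and its expansion at 1/2 -/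

/-- The speed at `σ` of the curve of normalised vectors `(n^{-σ})_n` on the unit sphere. -/
def zeroSpeed (σ : ℝ) : ℝ := √(logZetaDeriv2 (2 * σ))

lemma zeroSpeed_nonneg (σ : ℝ) : 0 ≤ zeroSpeed σ := Real.sqrt_nonneg _

lemma continuousOn_zeroSpeed : ContinuousOn zeroSpeed (Set.Ioi (1 / 2)) := by
  refine Real.continuous_sqrt.comp_continuousOn (continuousOn_logZetaDeriv2.comp
    (by fun_prop) ?_)
  intro x hx
  have : (1:ℝ)/2 < x := hx
  show 1 < 2 * x
  linarith

lemma zeroSpeed_le {σ : ℝ} (hσ : 3 / 2 ≤ σ) :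
    zeroSpeed σ ≤ √(logZetaDeriv2 3) * 2 ^ (3 / 2 : ℝ) * Real.exp (-Real.log 2 * σ) := by
  refine (Real.sqrt_le_sqrt (logZetaDeriv2_le (by linarith))).trans_eq ?_
  rw [Real.sqrt_mul (by positivity), mul_comm, mul_assoc]
  congr 1
  rw [Real.sqrt_eq_rpow, ← Real.rpow_mul (by norm_num), neg_mul, ← mul_neg, ← Real.rpow_def_of_pos
    (by norm_num), ← Real.rpow_add (by norm_num)]
  congr 1
  ring

lemma integrableOn_zeroSpeed {T : ℝ} (hT : 1 / 2 < T) : IntegrableOn zeroSpeed (Set.Ioi T) := by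
  have hc : ContinuousOn zeroSpeed (Set.Ici T) :=
    continuousOn_zeroSpeed.mono fun x hx => lt_of_lt_of_le hT hx
  refine integrable_of_isBigO_exp_neg (b := Real.log 2) (Real.log_pos (by norm_num)) hc ?_
  refine Asymptotics.IsBigO.of_bound (√(logZetaDeriv2 3) * 2 ^ (3 / 2 : ℝ)) ?_
  filter_upwards [eventually_ge_atTop (3 / 2 : ℝ)] with σ hσ
  rw [Real.norm_of_nonneg (zeroSpeed_nonneg σ), Real.norm_of_nonneg (Real.exp_nonneg _)]
  exact zeroSpeed_le hσ

/-- Termwise integration of `y * q y` for a power series `q`. -/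
lemma hasSum_integral_id_mul {q : ℝ → ℝ} {a : ℕ → ℝ} {r : ℝ} (hr : 0 < r)
    (hq : ∀ y, |y| ≤ r → HasSum (fun n => a n * y ^ n) (q y)) {x : ℝ} (hx : 0 ≤ x) (hxr : x ≤ r) :
    HasSum (fun n : ℕ => a n / (n + 2) * x ^ (n + 2)) (∫ y in (0 : ℝ)..x, y * q y) := by
  -- Unconditional convergence at the endpoint r is absolute, which supplies the dominating
  -- constants for termwise integration.
  have hs : Summable fun n => |a n| * r ^ n := by
    have := (hq r (abs_of_pos hr).le).summable.abs
    simpa [abs_mul, abs_pow, abs_of_pos hr] using this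
  have h := intervalIntegral.hasSum_integral_of_dominated_convergence (μ := volume) (a := 0)
    (b := x) (F := fun n y => a n * y ^ (n + 1)) (f := fun y => y * q y)
    (fun n _ => |a n| * r ^ n * r) (fun n => by fun_prop) ?_ ?_ ?_ ?_
  · refine h.congr_fun fun n => ?_
    rw [intervalIntegral.integral_const_mul, integral_pow]
    push_cast
    rw [zero_pow (by omega)]
    ring
  · intro n
    refine ae_of_all _ fun y hy => ?_
    rw [Set.uIoc_of_le hx] at hy
    rw [norm_mul, norm_pow, Real.norm_eq_abs, Real.norm_eq_abs, abs_of_pos hy.1, mul_assoc,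
      ← pow_succ]
    have := hy.2.trans hxr
    have := hy.1.le
    gcongr
  · exact ae_of_all _ fun y _ => hs.mul_right r
  · exact intervalIntegrable_const
  · refine ae_of_all _ fun y hy => ?_
    rw [Set.uIoc_of_le hx] at hy
    have := (hq y (by rw [abs_of_pos hy.1]; exact hy.2.trans hxr)).mul_left y
    refine this.congr_fun fun n => ?_
    ring

/-- Write the density as R/(2y) with R² = 1 + 4y²h(2y). Then R − 1 = 4y²h(2y)/(R+1), which leaves y
times an analytic function after the polar part 1/(2y). -/
lemma exists_zeroSpeed_expansion :
    ∃ (a : ℕ → ℝ) (q : ℝ → ℝ) (r : ℝ), 0 < r ∧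
      (∀ y, |y| ≤ r → HasSum (fun n => a n * y ^ n) (q y)) ∧
      ∀ y, 0 < y → y ≤ r → zeroSpeed (1 / 2 + y) = 1 / 2 * y⁻¹ + y * q y := by
  obtain ⟨h, hh, hw⟩ := exists_analyticAt_logZetaDeriv2
  have hh2 : AnalyticAt ℝ (fun y => h (2 * y)) 0 := by
    refine AnalyticAt.fun_comp (g := h) (f := fun y : ℝ => 2 * y) ?_ (by fun_prop)
    simpa using hh
  have hA : AnalyticAt ℝ (fun y => 1 + 4 * y ^ 2 * h (2 * y)) 0 :=
    analyticAt_const.add (AnalyticAt.mul (f := fun y : ℝ => 4 * y ^ 2) (by fun_prop) hh2)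
  -- The square root is written exp(½ log ·), so that analyticity follows from that of exp and log.
  have hlog : AnalyticAt ℝ (fun y => Real.exp (1 / 2 * Real.log (1 + 4 * y ^ 2 * h (2 * y)))) 0 :=
    ((analyticAt_const.mul (hA.log (by simp))) : AnalyticAt ℝ
      (fun y => 1 / 2 * Real.log (1 + 4 * y ^ 2 * h (2 * y))) 0).rexp
  have hq : AnalyticAt ℝ (fun y => 2 * h (2 * y) /
      (Real.exp (1 / 2 * Real.log (1 + 4 * y ^ 2 * h (2 * y))) + 1)) 0 :=
    (analyticAt_const.mul hh2).div (hlog.add analyticAt_const) (by positivity)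
  obtain ⟨p, hp⟩ := hq
  rw [hasFPowerSeriesAt_iff] at hp
  have hpos : ∀ᶠ y in 𝓝 (0:ℝ), 0 < 1 + 4 * y ^ 2 * h (2 * y) := by
    have := hA.continuousAt.tendsto
    refine this.eventually (lt_mem_nhds ?_)
    simp
  have hw2 : ∀ᶠ y in 𝓝[>] (0:ℝ), logZetaDeriv2 (1 + 2 * y) = 1 / (2 * y) ^ 2 + h (2 * y) := by
    have ht : Tendsto (fun y : ℝ => 2 * y) (𝓝[>] 0) (𝓝[>] 0) := by
      refine tendsto_nhdsWithin_iff.mpr ⟨?_, ?_⟩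
      · have : Continuous fun y : ℝ => 2 * y := by fun_prop
        simpa using (this.tendsto 0).mono_left nhdsWithin_le_nhds
      · filter_upwards [self_mem_nhdsWithin] with y hy
        have : (0:ℝ) < y := hy
        show 0 < 2 * y
        linarith
    exact ht.eventually hw
  rw [eventually_nhdsWithin_iff] at hw2
  obtain ⟨ε, hε, hball⟩ := Metric.eventually_nhds_iff.mp (hp.and (hpos.and hw2))
  refine ⟨p.coeff, fun y => 2 * h (2 * y) /
      (Real.exp (1 / 2 * Real.log (1 + 4 * y ^ 2 * h (2 * y))) + 1), ε / 2, by positivity, fun y hy => ?_, fun y hy hyr => ?_⟩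
  · have := (hball (y := y) (by rw [Real.dist_eq, sub_zero]; linarith)).1
    simp only [zero_add, smul_eq_mul] at this
    exact this.congr_fun fun n => by ring
  · obtain ⟨-, h1, h2⟩ := hball (y := y) (by rw [Real.dist_eq, sub_zero, abs_of_pos hy]; linarith)
    have h3 := h2 hy
    rw [zeroSpeed, show 2 * (1 / 2 + y) = 1 + 2 * y by ring, h3]
    set R := Real.exp (1 / 2 * Real.log (1 + 4 * y ^ 2 * h (2 * y))) with hR
    have hR2 : R ^ 2 = 1 + 4 * y ^ 2 * h (2 * y) := by
      rw [hR, ← Real.exp_nat_mul]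
      push_cast
      rw [← mul_assoc]
      norm_num
      exact Real.exp_log h1
    have hR0 : 0 < R := Real.exp_pos _
    have e1 : 1 / (2 * y) ^ 2 + h (2 * y) = (R / (2 * y)) ^ 2 := by
      rw [div_pow, hR2]
      field_simp
      ring
    rw [e1, Real.sqrt_sq (by positivity)]
    change R / (2 * y) = 1 / 2 * y⁻¹ + y * (2 * h (2 * y) / (R + 1))
    field_simp
    linear_combination hR2

lemma exists_integral_zeroSpeed_expansion :
    ∃ (δ c₀ : ℝ) (c : ℕ → ℝ), 0 < δ ∧ ∀ T ∈ Set.Ioo (1 / 2 : ℝ) (1 / 2 + δ),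
      Summable (fun n : ℕ => c (n + 2) * (T - 1 / 2) ^ (n + 2)) ∧
      ∫ σ in Set.Ioi T, zeroSpeed σ = 1 / 2 * Real.log (1 / (T - 1 / 2)) + c₀ +
        ∑' n : ℕ, c (n + 2) * (T - 1 / 2) ^ (n + 2) := by
  obtain ⟨a, q, r, hr, hq, hv⟩ := exists_zeroSpeed_expansion
  -- The constant gathers ½ log r, the integral of y q(y) over all of [0, r], and the tail beyond
  -- 1/2 + r. The coefficients come from −∫₀ˣ y q(y) dy; only the indices n + 2 are ever read.
  refine ⟨r, 1 / 2 * Real.log r + (∫ y in (0:ℝ)..r, y * q y) + ∫ σ in Set.Ioi (1 / 2 + r),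
    zeroSpeed σ, fun n => -(a (n - 2) / n), hr, fun T hT => ?_⟩
  obtain ⟨x, rfl⟩ : ∃ x, T = 1 / 2 + x := ⟨T - 1 / 2, by ring⟩
  have hx0 : 0 < x := by linarith [hT.1]
  have hxr : x < r := by linarith [hT.2]
  have hsum := (hasSum_integral_id_mul hr hq hx0.le hxr.le).neg
  have hsum' : HasSum (fun n : ℕ => (fun n : ℕ => -(a (n - 2) / n)) (n + 2) *
      (1 / 2 + x - 1 / 2) ^ (n + 2)) (-∫ y in (0 : ℝ)..x, y * q y) := by
    refine hsum.congr_fun fun n => ?_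
    simp
  refine ⟨hsum'.summable, ?_⟩
  rw [hsum'.tsum_eq]
  have hqc : ContinuousOn (fun y => y * q y) (Set.Icc 0 r) := by
    refine continuousOn_id.mul ?_
    have : ContinuousOn (fun y => ∑' n, a n * y ^ n) (Set.Icc 0 r) := by
      refine continuousOn_tsum (u := fun n => |a n| * r ^ n) (fun n => by fun_prop) ?_ ?_
      · have := (hq r (abs_of_pos hr).le).summable.abs
        simpa [abs_mul, abs_pow, abs_of_pos hr] using this
      · intro n y hy
        rw [norm_mul, norm_pow, Real.norm_eq_abs, Real.norm_eq_abs, abs_of_nonneg hy.1]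
        have := hy.1
        have := hy.2
        gcongr
    refine this.congr fun y hy => ?_
    exact (hq y (by rw [abs_of_nonneg hy.1]; exact hy.2)).tsum_eq.symm
  have hii : ∀ u v, u ∈ Set.Icc 0 r → v ∈ Set.Icc 0 r →
      IntervalIntegrable (fun y => y * q y) volume u v := fun u v hu hv =>
    (hqc.mono (by rw [← Set.uIcc_of_le hr.le] at *; exact Set.uIcc_subset_uIcc hu hv)).intervalIntegrable
  have h0 : (0:ℝ) ∈ Set.Icc 0 r := ⟨le_rfl, hr.le⟩
  have hr' : r ∈ Set.Icc 0 r := ⟨hr.le, le_rfl⟩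
  have hx' : x ∈ Set.Icc 0 r := ⟨hx0.le, hxr.le⟩
  have h1 : ∫ σ in Set.Ioi (1 / 2 + x), zeroSpeed σ =
      (∫ σ in (1 / 2 + x)..(1 / 2 + r), zeroSpeed σ) + ∫ σ in Set.Ioi (1 / 2 + r), zeroSpeed σ :=
    (intervalIntegral.integral_interval_add_Ioi (integrableOn_zeroSpeed (by linarith))
      (integrableOn_zeroSpeed (by linarith))).symm
  have h2 : ∫ σ in (1 / 2 + x)..(1 / 2 + r), zeroSpeed σ =
      ∫ y in x..r, (1 / 2 * y⁻¹ + y * q y) := by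
    rw [← intervalIntegral.integral_comp_add_left (fun σ => zeroSpeed σ) (1 / 2 : ℝ)]
    refine intervalIntegral.integral_congr fun y hy => ?_
    rw [Set.uIcc_of_le hxr.le] at hy
    exact hv y (hx0.trans_le hy.1) hy.2
  have h3 : ∫ y in x..r, (1 / 2 * y⁻¹ + y * q y) =
      1 / 2 * Real.log (r / x) + ∫ y in x..r, y * q y := by
    rw [intervalIntegral.integral_add _ (hii x r hx' hr'), intervalIntegral.integral_const_mul,
      integral_inv_of_pos hx0 hr]
    refine IntervalIntegrable.const_mul ?_ _
    exact intervalIntegral.intervalIntegrable_inv (fun y hy => by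
      rw [Set.uIcc_of_le hxr.le] at hy; linarith [hy.1]) continuousOn_id
  have h4 := intervalIntegral.integral_interval_sub_left (hii 0 r h0 hr') (hii 0 x h0 hx')
  rw [h1, h2, h3, ← h4, Real.log_div hr.ne' hx0.ne', add_sub_cancel_left, one_div x, Real.log_inv]
  ring

/-! ### Correlations and the Riemann sum of angles -/

/-- For θ the arccosine, sin θ = √(1 − e^{-y²}), and sin θ ≤ θ ≤ tan θ traps θ between y(1 − y²) and
y(1 + y²). A quadratic error suffices: summed over cells of width h it is O(h). -/
lemma abs_arccos_exp_sub_le {y : ℝ} (hy0 : 0 ≤ y) (hy : y ^ 2 ≤ 1 / 2) :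
    |Real.arccos (Real.exp (-y ^ 2 / 2)) - y| ≤ y ^ 2 := by
  have hy1 : y ≤ 1 := by nlinarith
  set c := Real.exp (-y ^ 2 / 2) with hc
  have hc0 : 0 < c := Real.exp_pos _
  have hc1 : c ≤ 1 := Real.exp_le_one_iff.mpr (by nlinarith)
  have hc2 : c ^ 2 = Real.exp (-y ^ 2) := by
    rw [hc, ← Real.exp_nat_mul]; congr 1; push_cast; ring
  set θ := Real.arccos c with hθ
  have hcos : Real.cos θ = c := Real.cos_arccos (by linarith) hc1
  have hθ0 : 0 ≤ θ := Real.arccos_nonneg c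
  have hθ1 : θ < Real.pi / 2 := Real.arccos_lt_pi_div_two.mpr hc0
  have hsin : Real.sin θ = √(1 - c ^ 2) := by rw [hθ, Real.sin_arccos]
  have hz0 := sq_nonneg y
  have e1 : Real.exp (-y ^ 2) * (1 + y ^ 2) ≤ 1 := by
    have h1 := Real.add_one_le_exp (y ^ 2)
    calc Real.exp (-y ^ 2) * (1 + y ^ 2) ≤ Real.exp (-y ^ 2) * Real.exp (y ^ 2) := by
          gcongr; linarith
      _ = 1 := by rw [← Real.exp_add]; simp
  have e2 : 1 - y ^ 2 ≤ c ^ 2 := by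
    rw [hc2]; linarith [Real.add_one_le_exp (-y ^ 2)]
  have lower : y * (1 - y ^ 2) ≤ Real.sin θ := by
    rw [hsin]
    apply Real.le_sqrt_of_sq_le
    rw [hc2]
    have h1 : Real.exp (-y ^ 2) ≤ 1 / (1 + y ^ 2) := by
      rw [le_div_iff₀ (by positivity)]; exact e1
    have h2 : 1 / (1 + y ^ 2) ≤ 1 - (y * (1 - y ^ 2)) ^ 2 := by
      rw [div_le_iff₀ (by positivity)]
      generalize hz : y ^ 2 = z at *
      have : (y * (1 - z)) ^ 2 = z * (1 - z) ^ 2 := by rw [mul_pow, hz]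
      rw [this]
      nlinarith [mul_nonneg hz0 hz0, mul_nonneg (mul_nonneg hz0 hz0) hz0,
        mul_nonneg (mul_nonneg hz0 hz0) (sub_nonneg.mpr hy)]
    linarith
  have upper : Real.sin θ ≤ c * (y * (1 + y ^ 2)) := by
    rw [hsin]
    apply Real.sqrt_le_iff.mpr ⟨by positivity, ?_⟩
    generalize hz : y ^ 2 = z at *
    have : (c * (y * (1 + z))) ^ 2 = c ^ 2 * (z * (1 + z) ^ 2) := by rw [mul_pow, mul_pow, hz]
    rw [this]
    -- The right side is 1 + z²(1 − z − z²), and the bracket is positive for z ≤ 1/2.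
    have h3 : 1 ≤ (1 - z) * (1 + z * (1 + z) ^ 2) := by
      nlinarith [mul_nonneg hz0 hz0, mul_nonneg (mul_nonneg hz0 hz0) (sub_nonneg.mpr hy),
        mul_nonneg (mul_nonneg (mul_nonneg hz0 hz0) hz0) (sub_nonneg.mpr hy),
        mul_nonneg hz0 (sub_nonneg.mpr hy)]
    have h4 : (1 - z) * (1 + z * (1 + z) ^ 2) ≤ c ^ 2 * (1 + z * (1 + z) ^ 2) := by gcongr
    linarith
  have u1 : θ ≤ y * (1 + y ^ 2) := by
    have h1 : θ ≤ Real.tan θ := Real.le_tan hθ0 hθ1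
    rw [Real.tan_eq_sin_div_cos, hcos] at h1
    refine h1.trans ?_
    rw [div_le_iff₀ hc0]
    linarith
  have l1 : y * (1 - y ^ 2) ≤ θ := lower.trans (Real.sin_le hθ0)
  have h3 : y * y ^ 2 ≤ y ^ 2 := by nlinarith
  rw [abs_le]
  constructor <;> nlinarith

/-- The correlation of the values at `s` and `t` of the random Dirichlet series. -/
def dirichletCorr (s t : ℝ) : ℝ := zetaReal (s + t) / √(zetaReal (2 * s) * zetaReal (2 * t))

lemma dirichletCorr_pos {s t : ℝ} (hs : 1 / 2 < s) (ht : 1 / 2 < t) : 0 < dirichletCorr s t :=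
  div_pos (zetaReal_pos (by linarith)) (Real.sqrt_pos.mpr
    (mul_pos (zetaReal_pos (by linarith)) (zetaReal_pos (by linarith))))

/-- With g = log ζ, Cauchy's mean value theorem compares g(s+t+r) + g(s+t−r) with r² on [0, t−s];
the ordinary mean value theorem for g' on [s+t−c, s+t+c] then produces g''. -/
lemma exists_log_zetaReal_second_difference {s t : ℝ} (hs : 1 / 2 < s) (hst : s < t) :
    ∃ ξ ∈ Set.Icc s t, Real.log (zetaReal (2 * t)) + Real.log (zetaReal (2 * s)) -
      2 * Real.log (zetaReal (s + t)) = (t - s) ^ 2 * logZetaDeriv2 (2 * ξ) := by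
  set g := fun y => Real.log (zetaReal y) with hg
  set g' := fun y : ℝ => -(LSeries (fun n => (ArithmeticFunction.vonMangoldt n : ℂ)) y).re with hg'
  have hg1 : ∀ u, 1 < u → HasDerivAt g (g' u) u := fun u hu => hasDerivAt_log_zetaReal hu
  have hg2 : ∀ u, 1 < u → HasDerivAt g' (logZetaDeriv2 u) u :=
    fun u hu => hasDerivAt_LSeries_vonMangoldt hu
  have hφ : ∀ r, |r| ≤ t - s → HasDerivAt (fun r => g (s + t + r) + g (s + t - r))
      (g' (s + t + r) - g' (s + t - r)) r := by
    intro r hr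
    rw [abs_le] at hr
    have h1 := (hg1 (s + t + r) (by linarith)).comp r ((hasDerivAt_id r).const_add (s + t))
    have h2 := (hg1 (s + t - r) (by linarith)).comp r ((hasDerivAt_id r).const_sub (s + t))
    exact (h1.add h2).congr_deriv (by simp; ring)
  obtain ⟨c, hc, hceq⟩ := exists_ratio_hasDerivAt_eq_ratio_slope
    (fun r => g (s + t + r) + g (s + t - r)) (fun r => g' (s + t + r) - g' (s + t - r))
    (sub_pos.mpr hst)
    (fun r hr => (hφ r (by rw [abs_of_nonneg hr.1]; exact hr.2)).continuousAt.continuousWithinAt)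
    (fun r hr => hφ r (by rw [abs_of_pos hr.1]; exact hr.2.le))
    (fun r => r ^ 2) (fun r => 2 * r) (by fun_prop)
    (fun r _ => by simpa using hasDerivAt_pow 2 r)
  obtain ⟨ξ, hξ, hξeq⟩ := exists_hasDerivAt_eq_slope g' logZetaDeriv2
    (a := s + t - c) (b := s + t + c) (by linarith [hc.1])
    (fun r hr => (hg2 r (by linarith [hr.1, hc.2])).continuousAt.continuousWithinAt)
    (fun r hr => hg2 r (by linarith [hr.1, hc.2]))
  refine ⟨ξ / 2, ⟨by linarith [hξ.1, hc.2], by linarith [hξ.2, hc.2]⟩, ?_⟩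
  have hc0 : c ≠ 0 := hc.1.ne'
  rw [show 2 * (ξ / 2) = ξ by ring, hξeq]
  have e1 : s + t + c - (s + t - c) = 2 * c := by ring
  rw [e1]
  have e2 : s + t + (t - s) = 2 * t := by ring
  have e3 : s + t - (t - s) = 2 * s := by ring
  simp only [e2, e3, add_zero, sub_zero] at hceq
  change g (2 * t) + g (2 * s) - 2 * g (s + t) = _
  field_simp
  linear_combination -hceq

/-- The logarithm of the correlation is minus half the second difference of log ζ. The identity is
exact, the only unknown being the intermediate point, so uniform continuity of the density controls
all cells at once. -/
lemma exists_dirichletCorr_eq {s t : ℝ} (hs : 1 / 2 < s) (hst : s < t) :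
    ∃ ξ ∈ Set.Icc s t, dirichletCorr s t = Real.exp (-((t - s) * zeroSpeed ξ) ^ 2 / 2) := by
  obtain ⟨ξ, hξ, h⟩ := exists_log_zetaReal_second_difference hs hst
  refine ⟨ξ, hξ, ?_⟩
  have p1 := zetaReal_pos (u := 2 * s) (by linarith)
  have p2 := zetaReal_pos (u := 2 * t) (by linarith)
  have p3 := zetaReal_pos (u := s + t) (by linarith)
  rw [← Real.exp_log (dirichletCorr_pos hs (hs.trans hst)), dirichletCorr,
    Real.log_div p3.ne' (by positivity), Real.log_sqrt (by positivity),
    Real.log_mul p1.ne' p2.ne', zeroSpeed, mul_pow, Real.sq_sqrt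
      (logZetaDeriv2_nonneg (by linarith [hξ.1]))]
  congr 1
  linarith

lemma dirichletCorr_le_one {s t : ℝ} (hs : 1 / 2 < s) (hst : s < t) : dirichletCorr s t ≤ 1 := by
  obtain ⟨ξ, -, h⟩ := exists_dirichletCorr_eq hs hst
  rw [h, Real.exp_le_one_iff]
  have := sq_nonneg ((t - s) * zeroSpeed ξ)
  linarith

/-- The `i`-th point of the division of `[a, b]` into `n + 1` equal cells. -/
def gridPoint (a b : ℝ) (n i : ℕ) : ℝ := a + i * ((b - a) / (n + 1))

@[simp] lemma gridPoint_zero (a b : ℝ) (n : ℕ) : gridPoint a b n 0 = a := by simp [gridPoint]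

@[simp] lemma gridPoint_last (a b : ℝ) (n : ℕ) : gridPoint a b n (n + 1) = b := by
  rw [gridPoint]; push_cast; field_simp; ring

lemma gridPoint_succ_sub (a b : ℝ) (n i : ℕ) :
    gridPoint a b n (i + 1) - gridPoint a b n i = (b - a) / (n + 1) := by
  simp only [gridPoint]; push_cast; ring

lemma gridPoint_mono {a b : ℝ} (hab : a ≤ b) (n : ℕ) : Monotone (gridPoint a b n) := by
  refine monotone_nat_of_le_succ fun i => ?_
  have := gridPoint_succ_sub a b n i
  have : 0 ≤ (b - a) / (n + 1) := div_nonneg (by linarith) (by positivity)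
  linarith

lemma gridPoint_mem {a b : ℝ} (hab : a ≤ b) {n i : ℕ} (hi : i ≤ n + 1) :
    gridPoint a b n i ∈ Set.Icc a b := by
  constructor
  · simpa using gridPoint_mono hab n (Nat.zero_le i)
  · simpa using gridPoint_mono hab n hi

lemma tendsto_gridMesh (a b : ℝ) :
    Tendsto (fun n : ℕ => (b - a) / ((n : ℝ) + 1)) atTop (𝓝 0) := by
  have := (tendsto_one_div_add_atTop_nhds_zero_nat (𝕜 := ℝ)).const_mul (b - a)
  simpa [div_eq_mul_inv] using this

lemma tendsto_sum_arccos_dirichletCorr {a b : ℝ} (ha : 1 / 2 < a) (hab : a < b) :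
    Tendsto (fun n : ℕ => ∑ i ∈ Finset.range (n + 1),
      Real.arccos (dirichletCorr (gridPoint a b n i) (gridPoint a b n (i + 1))))
      atTop (𝓝 (∫ σ in a..b, zeroSpeed σ)) := by
  have hcont : ContinuousOn zeroSpeed (Set.Icc a b) :=
    continuousOn_zeroSpeed.mono fun x hx => lt_of_lt_of_le ha hx.1
  obtain ⟨M, hM⟩ := isCompact_Icc.exists_bound_of_continuousOn hcont
  have hM0 : 0 ≤ M := (norm_nonneg _).trans (hM a ⟨le_rfl, hab.le⟩)
  have hunif := isCompact_Icc.uniformContinuousOn_of_continuous hcont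
  rw [Metric.uniformContinuousOn_iff] at hunif
  have hba : 0 < b - a := sub_pos.mpr hab
  have hint : ∀ u ∈ Set.Icc a b, ∀ v ∈ Set.Icc a b, IntervalIntegrable zeroSpeed volume u v :=
    fun u hu v hv => (hcont.mono (by
      rw [← Set.uIcc_of_le hab.le] at *; exact Set.uIcc_subset_uIcc hu hv)).intervalIntegrable
  rw [Metric.tendsto_atTop']
  intro ε hε
  -- Each cell of width h will err by at most 2ε'h: one ε'h for the angle, which needs hM < 1/2 and
  -- hM² < ε', and one for the oscillation of the density. The widths add up to b − a, so the total
  -- is 2ε/3.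
  set ε' := ε / (3 * (b - a)) with hε'
  have hε'0 : 0 < ε' := by positivity
  obtain ⟨η, hη, hηu⟩ := hunif ε' hε'0
  have hmesh := tendsto_gridMesh a b
  have ev1 := hmesh.eventually (gt_mem_nhds hη)
  have ev2 := (by simpa using hmesh.mul_const M : Tendsto (fun n : ℕ => (b - a) / ((n : ℝ) + 1) * M)
    atTop (𝓝 0)).eventually (gt_mem_nhds (show (0:ℝ) < 1 / 2 by norm_num))
  have ev3 := (by simpa using hmesh.mul_const (M ^ 2) :
    Tendsto (fun n : ℕ => (b - a) / ((n : ℝ) + 1) * M ^ 2)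
    atTop (𝓝 0)).eventually (gt_mem_nhds hε'0)
  obtain ⟨N, hN⟩ := eventually_atTop.mp (ev1.and (ev2.and ev3))
  refine ⟨N, fun n hn => ?_⟩
  obtain ⟨h1, h2, h3⟩ := hN n hn.le
  set h := (b - a) / ((n : ℝ) + 1) with hh
  have hh0 : 0 < h := by positivity
  have hsum := intervalIntegral.sum_integral_adjacent_intervals (f := zeroSpeed) (μ := volume)
    (a := gridPoint a b n) (n := n + 1) (fun k hk => hint _ (gridPoint_mem hab.le (by omega)) _
      (gridPoint_mem hab.le (by omega)))
  rw [gridPoint_zero, gridPoint_last] at hsum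
  rw [Real.dist_eq, ← hsum, ← Finset.sum_sub_distrib]
  have hcell : ∀ i ∈ Finset.range (n + 1),
      |Real.arccos (dirichletCorr (gridPoint a b n i) (gridPoint a b n (i + 1))) -
        ∫ σ in (gridPoint a b n i)..(gridPoint a b n (i + 1)), zeroSpeed σ| ≤ 2 * ε' * h := by
    intro i hi
    rw [Finset.mem_range] at hi
    have m1 := gridPoint_mem hab.le (show i ≤ n + 1 by omega)
    have m2 := gridPoint_mem hab.le (show i + 1 ≤ n + 1 by omega)
    have hd := gridPoint_succ_sub a b n i
    rw [← hh] at hd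
    set s := gridPoint a b n i
    set t := gridPoint a b n (i + 1)
    obtain ⟨ξ, hξ, hcorr⟩ := exists_dirichletCorr_eq (s := s) (t := t) (by linarith [m1.1])
      (by linarith)
    rw [hcorr, hd]
    have hξm : ξ ∈ Set.Icc a b := ⟨m1.1.trans hξ.1, hξ.2.trans m2.2⟩
    have hv0 := zeroSpeed_nonneg ξ
    have hvM : zeroSpeed ξ ≤ M := (Real.le_norm_self _).trans (hM ξ hξm)
    have hy : h * zeroSpeed ξ ≤ h * M := by gcongr
    have hy0 : 0 ≤ h * zeroSpeed ξ := by positivity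
    have b1 := abs_arccos_exp_sub_le hy0 (by nlinarith)
    have b2 : (h * zeroSpeed ξ) ^ 2 ≤ ε' * h := by
      calc (h * zeroSpeed ξ) ^ 2 ≤ (h * M) ^ 2 := by gcongr
        _ = (h * M ^ 2) * h := by ring
        _ ≤ ε' * h := by gcongr
    have b3 : |h * zeroSpeed ξ - ∫ σ in s..t, zeroSpeed σ| ≤ ε' * h := by
      have e1 : h * zeroSpeed ξ = ∫ σ in s..t, zeroSpeed ξ := by
        rw [intervalIntegral.integral_const, hd, smul_eq_mul]
      rw [e1, ← intervalIntegral.integral_sub intervalIntegrable_const (hint s m1 t m2)]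
      have := intervalIntegral.norm_integral_le_of_norm_le_const (a := s) (b := t) (C := ε')
        (f := fun σ => zeroSpeed ξ - zeroSpeed σ) (fun σ hσ => ?_)
      · rwa [Real.norm_eq_abs, hd, abs_of_pos hh0] at this
      · rw [Set.uIoc_of_le (by linarith)] at hσ
        rw [← dist_eq_norm]
        refine (hηu ξ hξm σ ⟨m1.1.trans hσ.1.le, hσ.2.trans m2.2⟩ ?_).le
        rw [Real.dist_eq, abs_lt]
        constructor <;> linarith [hξ.1, hξ.2, hσ.1, hσ.2]
    calc _ ≤ |Real.arccos (Real.exp (-(h * zeroSpeed ξ) ^ 2 / 2)) - h * zeroSpeed ξ| +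
          |h * zeroSpeed ξ - ∫ σ in s..t, zeroSpeed σ| := abs_sub_le _ _ _
      _ ≤ 2 * ε' * h := by linarith
  refine (Finset.abs_sum_le_sum_abs _ _).trans_lt ((Finset.sum_le_sum hcell).trans_lt ?_)
  rw [Finset.sum_const, Finset.card_range, nsmul_eq_mul]
  have : ((n + 1 : ℕ) : ℝ) * (2 * ε' * h) = 2 / 3 * ε := by
    rw [hh, hε']; push_cast; field_simp
  rw [this]
  linarith

/-! ### The Gaussian plane and Sheppard's formula -/

/-- The standard Gaussian measure on the plane. -/
abbrev gaussianPlane : Measure (ℝ × ℝ) := (gaussianReal 0 1).prod (gaussianReal 0 1)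

/-- The radial mass of the standard Gaussian measure of the plane in polar coordinates. -/
def gaussianRadialMass : ENNReal :=
  ∫⁻ r in Set.Ioi (0 : ℝ), ENNReal.ofReal (r * (1 / (2 * Real.pi) * Real.exp (-r ^ 2 / 2)))

lemma gaussianPlane_eq_withDensity :
    gaussianPlane = (volume : Measure (ℝ × ℝ)).withDensity
      fun p => ENNReal.ofReal (1 / (2 * Real.pi) * Real.exp (-(p.1 ^ 2 + p.2 ^ 2) / 2)) := by
  rw [gaussianPlane, gaussianReal_of_var_ne_zero 0 one_ne_zero,
    prod_withDensity (measurable_gaussianPDF 0 1) (measurable_gaussianPDF 0 1),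
    ← Measure.volume_eq_prod]
  congr 1
  ext p
  rw [gaussianPDF, gaussianPDF, ← ENNReal.ofReal_mul (gaussianPDFReal_nonneg _ _ _)]
  congr 1
  simp only [gaussianPDFReal, NNReal.coe_one, mul_one, sub_zero]
  rw [mul_mul_mul_comm, ← Real.exp_add, ← mul_inv, Real.mul_self_sqrt (by positivity), one_div]
  congr 2
  ring

/-- The density is rotation invariant, so in polar coordinates the mass of a cone splits into a
radial factor and the length of its set of angles. -/
lemma gaussianPlane_cone {S : Set (ℝ × ℝ)} {A : Set ℝ} (hS : MeasurableSet S)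
    (hA : MeasurableSet A)
    (hSA : ∀ r φ : ℝ, 0 < r → ((r * Real.cos φ, r * Real.sin φ) ∈ S ↔ φ ∈ A)) :
    gaussianPlane S = gaussianRadialMass * volume (A ∩ Set.Ioo (-Real.pi) Real.pi) := by
  have hvol : (volume : Measure ℝ) (A ∩ Set.Ioo (-Real.pi) Real.pi) =
      ∫⁻ φ in Set.Ioo (-Real.pi) Real.pi, A.indicator 1 φ := by
    rw [lintegral_indicator_one hA, Measure.restrict_apply hA]
  rw [gaussianPlane_eq_withDensity, withDensity_apply _ hS, ← lintegral_indicator hS,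
    ← lintegral_comp_polarCoord_symm, hvol, gaussianRadialMass]
  rw [← lintegral_prod_mul (by fun_prop) ((measurable_one.indicator hA).aemeasurable),
    Measure.prod_restrict, ← Measure.volume_eq_prod]
  refine setLIntegral_congr_fun polarCoord.open_target.measurableSet fun p hp => ?_
  have hp1 : 0 < p.1 := hp.1
  have hsymm : polarCoord.symm p = (p.1 * Real.cos p.2, p.1 * Real.sin p.2) := rfl
  rw [hsymm]
  by_cases h : p.2 ∈ A
  · simp only [Set.indicator_of_mem h, Set.indicator_of_mem ((hSA p.1 p.2 hp1).mpr h)]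
    rw [smul_eq_mul, ← ENNReal.ofReal_mul hp1.le, Pi.one_apply, mul_one]
    congr 4
    rw [mul_pow, mul_pow, ← mul_add, Real.cos_sq_add_sin_sq, mul_one]
  · simp only [Set.indicator_of_notMem h,
      Set.indicator_of_notMem (fun h' => h ((hSA p.1 p.2 hp1).mp h')), smul_zero, mul_zero]

/-- The whole plane is a cone of total mass 1; this determines the radial factor without evaluating
an integral. -/
lemma gaussianRadialMass_mul : gaussianRadialMass * ENNReal.ofReal (2 * Real.pi) = 1 := by
  have h := gaussianPlane_cone (S := Set.univ) (A := Set.univ) .univ .univ (by simp)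
  rw [measure_univ, Set.univ_inter, Real.volume_Ioo] at h
  rw [h]
  congr 2
  ring

lemma cos_mul_cos_sub_neg_iff {θ φ : ℝ} (h0 : 0 ≤ θ) (h1 : θ ≤ Real.pi / 2)
    (hφ : φ ∈ Set.Ioo (-Real.pi) Real.pi) :
    Real.cos φ * Real.cos (φ - θ) < 0 ↔
      φ ∈ Set.Ioo (-(Real.pi / 2)) (θ - Real.pi / 2) ∪ Set.Ioo (Real.pi / 2) (Real.pi / 2 + θ) := by
  have hpi := Real.pi_pos
  obtain ⟨ha, hb⟩ := hφ
  have hneg : ∀ x, -(Real.pi + Real.pi / 2) ≤ x → x ≤ -(Real.pi / 2) → Real.cos x ≤ 0 :=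
    fun x hx hx' => by
      rw [← Real.cos_neg]
      exact Real.cos_nonpos_of_pi_div_two_le_of_le (by linarith) (by linarith)
  constructor
  · intro h
    by_contra hn
    rw [Set.mem_union, not_or, Set.mem_Ioo, Set.mem_Ioo, not_and, not_and] at hn
    refine absurd h (not_lt.mpr ?_)
    rcases le_or_gt φ (-(Real.pi / 2)) with c1 | c1
    · exact mul_nonneg_of_nonpos_of_nonpos (hneg _ (by linarith) c1)
        (hneg _ (by linarith) (by linarith))
    · have c2 := not_lt.mp (hn.1 c1)
      rcases le_or_gt φ (Real.pi / 2) with c3 | c3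
      · exact mul_nonneg (Real.cos_nonneg_of_mem_Icc ⟨c1.le, c3⟩)
          (Real.cos_nonneg_of_mem_Icc ⟨by linarith, by linarith⟩)
      · have c4 := not_lt.mp (hn.2 c3)
        exact mul_nonneg_of_nonpos_of_nonpos
          (Real.cos_nonpos_of_pi_div_two_le_of_le (by linarith) (by linarith))
          (Real.cos_nonpos_of_pi_div_two_le_of_le (by linarith) (by linarith))
  · rintro (⟨c1, c2⟩ | ⟨c1, c2⟩)
    · refine mul_neg_of_pos_of_neg (Real.cos_pos_of_mem_Ioo ⟨c1, by linarith⟩) ?_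
      rw [← Real.cos_neg]
      exact Real.cos_neg_of_pi_div_two_lt_of_lt (by linarith) (by linarith)
    · exact mul_neg_of_neg_of_pos (Real.cos_neg_of_pi_div_two_lt_of_lt c1 (by linarith))
        (Real.cos_pos_of_mem_Ioo ⟨by linarith, by linarith⟩)

/-- Sheppard's formula. -/
lemma gaussianPlane_mul_neg {θ : ℝ} (h0 : 0 ≤ θ) (h1 : θ ≤ Real.pi / 2) :
    gaussianPlane {p | p.1 * (Real.cos θ * p.1 + Real.sin θ * p.2) < 0} =
      ENNReal.ofReal (θ / Real.pi) := by
  have hpi := Real.pi_pos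
  have hA : MeasurableSet {φ : ℝ | Real.cos φ * Real.cos (φ - θ) < 0} :=
    measurableSet_lt (by fun_prop) (by fun_prop)
  -- At (r cos φ, r sin φ) the product equals r² cos φ cos(φ − θ). The set is thus a cone, whose
  -- angles form two arcs of length θ.
  rw [gaussianPlane_cone (A := {φ | Real.cos φ * Real.cos (φ - θ) < 0})
    (measurableSet_lt (by fun_prop) (by fun_prop)) hA ?_]
  · have hset : {φ : ℝ | Real.cos φ * Real.cos (φ - θ) < 0} ∩ Set.Ioo (-Real.pi) Real.pi =
        Set.Ioo (-(Real.pi / 2)) (θ - Real.pi / 2) ∪ Set.Ioo (Real.pi / 2) (Real.pi / 2 + θ) := by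
      ext φ
      constructor
      · exact fun h => (cos_mul_cos_sub_neg_iff h0 h1 h.2).mp h.1
      · intro h
        have hφ : φ ∈ Set.Ioo (-Real.pi) Real.pi := by
          rcases h with ⟨c1, c2⟩ | ⟨c1, c2⟩ <;> constructor <;> linarith
        exact ⟨(cos_mul_cos_sub_neg_iff h0 h1 hφ).mpr h, hφ⟩
    rw [hset, measure_union (Set.disjoint_left.mpr fun x hx hy => by
      linarith [hx.2, hy.1]) measurableSet_Ioo, Real.volume_Ioo, Real.volume_Ioo,
      ← ENNReal.ofReal_add (by linarith) (by linarith)]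
    have e : θ - Real.pi / 2 - -(Real.pi / 2) + (Real.pi / 2 + θ - Real.pi / 2) =
        2 * Real.pi * (θ / Real.pi) := by field_simp; ring
    rw [e, ENNReal.ofReal_mul (by positivity), ← mul_assoc, gaussianRadialMass_mul, one_mul]
  · intro r φ hr
    have e : r * Real.cos φ * (Real.cos θ * (r * Real.cos φ) + Real.sin θ * (r * Real.sin φ)) =
        r ^ 2 * (Real.cos φ * Real.cos (φ - θ)) := by rw [Real.cos_sub]; ring
    simp only [Set.mem_ofPred_eq, e]
    exact ⟨fun h => by by_contra hn; exact absurd h (not_lt.mpr (mul_nonneg (sq_nonneg r)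
      (not_lt.mp hn))), fun h => mul_neg_of_pos_of_neg (by positivity) h⟩

/-! ### Joint laws of Gaussian series -/

/-- The law of a sequence of independent standard Gaussian variables. -/
abbrev gaussianSeq : Measure (ℕ → ℝ) := Measure.infinitePi fun _ => gaussianReal 0 1

lemma iIndepFun_gaussianSeq : iIndepFun (fun (n : ℕ) (x : ℕ → ℝ) => x n) gaussianSeq :=
  iIndepFun_infinitePi (X := fun _ x => x) (fun _ => measurable_id)

lemma map_eval_gaussianSeq (n : ℕ) :
    gaussianSeq.map (fun x : ℕ → ℝ => x n) = gaussianReal 0 1 :=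
  (measurePreserving_eval_infinitePi (fun _ => gaussianReal 0 1) n).map_eq

lemma integral_cexp_gaussianReal (t : ℝ) :
    ∫ x, Complex.exp ((t * x : ℝ) * Complex.I) ∂(gaussianReal 0 1) =
      Complex.exp (-(t ^ 2 / 2 : ℝ)) := by
  have h := charFun_gaussianReal (μ := 0) (v := 1) t
  rw [charFun_apply_real] at h
  convert h using 2
  · ext x; push_cast; rfl
  · push_cast; simp

lemma integral_cexp_sum_gaussianSeq (e : ℕ → ℝ) (N : ℕ) :
    ∫ x, Complex.exp ((∑ n ∈ Finset.range N, e n * x n : ℝ) * Complex.I) ∂gaussianSeq =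
      Complex.exp (-((∑ n ∈ Finset.range N, e n ^ 2) / 2 : ℝ)) := by
  have hind : iIndepFun (fun (n : ℕ) (x : ℕ → ℝ) => e n * x n) gaussianSeq :=
    iIndepFun_gaussianSeq.comp (fun n y => e n * y) (fun n => by fun_prop)
  have h := congrFun ((hind.restrict (Finset.range N)).charFun_map_fun_finsetSum_eq_prod
    (fun n _ => Measurable.aemeasurable (by fun_prop))) 1
  rw [charFun_apply_real, integral_map (Finset.measurable_fun_sum _ fun n _ =>
    by fun_prop).aemeasurable (by fun_prop), Finset.prod_apply] at h
  have h2 : ∀ n, charFun (gaussianSeq.map fun x : ℕ → ℝ => e n * x n) 1 =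
      Complex.exp (-(e n ^ 2 / 2 : ℝ)) := by
    intro n
    have : (fun x : ℕ → ℝ => e n * x n) = (fun y => e n * y) ∘ fun x : ℕ → ℝ => x n := rfl
    rw [this, ← Measure.map_map (by fun_prop) (by fun_prop), map_eval_gaussianSeq,
      charFun_apply_real, integral_map (by fun_prop) (by fun_prop), ← integral_cexp_gaussianReal]
    simp
  simp_rw [h2, ← Complex.exp_sum] at h
  convert h using 2
  · simp
  · push_cast; rw [Finset.sum_neg_distrib, Finset.sum_div]

lemma integral_cexp_gaussianPlane (u v : ℝ) :
    ∫ p, Complex.exp ((u * p.1 + v * p.2 : ℝ) * Complex.I) ∂gaussianPlane =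
      Complex.exp (-((u ^ 2 + v ^ 2) / 2 : ℝ)) := by
  have e : ∀ p : ℝ × ℝ, Complex.exp ((u * p.1 + v * p.2 : ℝ) * Complex.I) =
      Complex.exp ((u * p.1 : ℝ) * Complex.I) * Complex.exp ((v * p.2 : ℝ) * Complex.I) := by
    intro p
    rw [← Complex.exp_add]; push_cast; ring_nf
  simp_rw [e]
  rw [integral_prod_mul (fun x : ℝ => Complex.exp ((u * x : ℝ) * Complex.I))
    (fun x : ℝ => Complex.exp ((v * x : ℝ) * Complex.I)), integral_cexp_gaussianReal,
    integral_cexp_gaussianReal, ← Complex.exp_add]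
  congr 1; push_cast; ring

/-- The joint law of two almost surely convergent Gaussian series. -/
lemma map_gaussian_series_eq {c d : ℕ → ℝ} {f g : (ℕ → ℝ) → ℝ} {α β θ : ℝ}
    (hcc : HasSum (fun n => c n ^ 2) (α ^ 2)) (hdd : HasSum (fun n => d n ^ 2) (β ^ 2))
    (hcd : HasSum (fun n => c n * d n) (α * β * Real.cos θ))
    (hf : AEMeasurable f gaussianSeq) (hg : AEMeasurable g gaussianSeq)
    (hcf : ∀ᵐ x ∂gaussianSeq,
      Tendsto (fun N => ∑ n ∈ Finset.range N, c n * x n) atTop (𝓝 (f x)))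
    (hdg : ∀ᵐ x ∂gaussianSeq,
      Tendsto (fun N => ∑ n ∈ Finset.range N, d n * x n) atTop (𝓝 (g x))) :
    gaussianSeq.map (fun x => (f x, g x)) =
      gaussianPlane.map fun p => (α * p.1, β * (Real.cos θ * p.1 + Real.sin θ * p.2)) := by
  have i1 := Measure.isProbabilityMeasure_map (μ := gaussianSeq)
    (hf.prodMk hg)
  have hm : Measurable fun p : ℝ × ℝ =>
    (α * p.1, β * (Real.cos θ * p.1 + Real.sin θ * p.2)) := by fun_prop
  have i2 := Measure.isProbabilityMeasure_map (μ := gaussianPlane) hm.aemeasurable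
  refine Measure.ext_of_charFunDual (funext fun L => ?_)
  set a := L (1, 0)
  set b := L (0, 1)
  have hL : ∀ y z : ℝ, L (y, z) = a * y + b * z := by
    intro y z
    have : ((y, z) : ℝ × ℝ) = y • (1, 0) + z • (0, 1) := by simp
    rw [this, map_add, map_smul, map_smul, smul_eq_mul, smul_eq_mul]
    ring
  rw [charFunDual_apply, charFunDual_apply, integral_map (by fun_prop) (by fun_prop),
    integral_map (by fun_prop) (by fun_prop)]
  have hR : ∫ p, Complex.exp (L (α * p.1, β * (Real.cos θ * p.1 + Real.sin θ * p.2)) * Complex.I)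
      ∂gaussianPlane =
      Complex.exp (-((a ^ 2 * α ^ 2 + 2 * (a * b) * (α * β * Real.cos θ) + b ^ 2 * β ^ 2) / 2 : ℝ)) := by
    have e : ∀ p : ℝ × ℝ, L (α * p.1, β * (Real.cos θ * p.1 + Real.sin θ * p.2)) =
        (a * α + b * β * Real.cos θ) * p.1 + (b * β * Real.sin θ) * p.2 := by
      intro p; rw [hL]; ring
    simp_rw [e]
    rw [integral_cexp_gaussianPlane]
    congr 4
    linear_combination (b * β) ^ 2 * Real.sin_sq_add_cos_sq θ
  rw [hR]
  -- The characteristic functions of the partial sums have two limits to be identified: by dominated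
  -- convergence, that of the limiting pair; by explicit computation, the Gaussian one.
  have hlim1 : Tendsto (fun N => ∫ x, Complex.exp
      ((∑ n ∈ Finset.range N, (a * c n + b * d n) * x n : ℝ) * Complex.I) ∂gaussianSeq) atTop
      (𝓝 (∫ x, Complex.exp (L (f x, g x) * Complex.I) ∂gaussianSeq)) := by
    refine tendsto_integral_of_dominated_convergence (fun _ => 1)
      (fun N => (Measurable.cexp ((Complex.measurable_ofReal.comp (Finset.measurable_fun_sum _
        fun n _ => (measurable_pi_apply n).const_mul _)).mul_const _)).aestronglyMeasurable)
      (integrable_const _) (fun N => ae_of_all _ fun x => ?_) ?_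
    · rw [Complex.norm_exp_ofReal_mul_I]
    · filter_upwards [hcf, hdg] with x h1 h2
      have h3 := (h1.const_mul a).add (h2.const_mul b)
      rw [← hL] at h3
      have h4 : Tendsto (fun N => ∑ n ∈ Finset.range N, (a * c n + b * d n) * x n) atTop
          (𝓝 (L (f x, g x))) := by
        refine h3.congr fun N => ?_
        rw [Finset.mul_sum, Finset.mul_sum, ← Finset.sum_add_distrib]
        exact Finset.sum_congr rfl fun n _ => by ring
      have hc : Continuous fun y : ℝ => Complex.exp (y * Complex.I) := by fun_prop
      exact (hc.tendsto _).comp h4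
  have hlim2 : Tendsto (fun N => ∫ x, Complex.exp
      ((∑ n ∈ Finset.range N, (a * c n + b * d n) * x n : ℝ) * Complex.I) ∂gaussianSeq) atTop
      (𝓝 (Complex.exp (-((a ^ 2 * α ^ 2 + 2 * (a * b) * (α * β * Real.cos θ) +
        b ^ 2 * β ^ 2) / 2 : ℝ)))) := by
    simp_rw [integral_cexp_sum_gaussianSeq]
    have hs : HasSum (fun n => (a * c n + b * d n) ^ 2)
        (a ^ 2 * α ^ 2 + 2 * (a * b) * (α * β * Real.cos θ) + b ^ 2 * β ^ 2) := by
      refine (((hcc.mul_left (a ^ 2)).add (hcd.mul_left (2 * (a * b)))).add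
        (hdd.mul_left (b ^ 2))).congr_fun fun n => by ring
    have hc : Continuous fun y : ℝ => Complex.exp (-((y / 2 : ℝ) : ℂ)) := by fun_prop
    exact (hc.tendsto _).comp hs.tendsto_sum_nat
  exact tendsto_nhds_unique hlim1 hlim2

lemma gaussianReal_abs_le (ε : ℝ) :
    gaussianReal 0 1 {y | |y| ≤ ε} ≤ ENNReal.ofReal (2 * ε) := by
  have hset : {y : ℝ | |y| ≤ ε} = Set.Icc (-ε) ε := by ext y; simp [abs_le]
  rw [hset, gaussianReal_apply 0 one_ne_zero]
  calc ∫⁻ x in Set.Icc (-ε) ε, gaussianPDF 0 1 x ≤ ∫⁻ x in Set.Icc (-ε) ε, 1 := by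
        refine lintegral_mono fun x => ?_
        rw [gaussianPDF, ENNReal.ofReal_le_one, gaussianPDFReal]
        have h1 : (√(2 * Real.pi * (1 : NNReal)))⁻¹ ≤ 1 := by
          apply inv_le_one_of_one_le₀
          rw [Real.one_le_sqrt]
          have := Real.pi_gt_three
          simp; linarith
        have h2 : Real.exp (-(x - 0) ^ 2 / (2 * (1 : NNReal))) ≤ 1 := by
          rw [Real.exp_le_one_iff]
          have := sq_nonneg (x - 0)
          simp; nlinarith
        exact mul_le_one₀ h1 (Real.exp_nonneg _) h2
    _ = ENNReal.ofReal (2 * ε) := by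
        rw [setLIntegral_one, Real.volume_Icc]; congr 1; ring

/-! ### Almost sure growth of the coefficient sums, partial summation and smoothness -/

/-- The partial sums of `x` grow at most like `N^{1/2+ε}`, for every `ε > 0`. -/
def SqrtGrowth (x : ℕ → ℝ) : Prop :=
  ∀ ε : ℝ, 0 < ε → (fun N : ℕ => ∑ n ∈ Finset.range N, x n) =O[atTop] fun N : ℕ => (N : ℝ) ^ (1 / 2 + ε)

lemma hasSubgaussianMGF_gaussianSeq (n : ℕ) :
    HasSubgaussianMGF (fun x : ℕ → ℝ => x n) 1 gaussianSeq where
  integrable_exp_mul t := by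
    have h := integrable_exp_mul_gaussianReal (μ := 0) (v := 1) t
    rw [← map_eval_gaussianSeq n] at h
    exact h.comp_measurable (measurable_pi_apply n)
  mgf_le t := by
    rw [mgf_gaussianReal (map_eval_gaussianSeq n)]
    simp

/-- The deviation √(4N log N) is tuned to make the sub-Gaussian tail N^{-2}, which is summable. -/
lemma exp_neg_sq_sqrt_log {N : ℕ} (hN : 1 ≤ N) :
    Real.exp (-√(4 * N * Real.log N) ^ 2 / (2 * N)) = 1 / (N : ℝ) ^ 2 := by
  have hN' : (0 : ℝ) < N := by exact_mod_cast hN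
  rw [Real.sq_sqrt (mul_nonneg (by positivity) (Real.log_natCast_nonneg N))]
  have e : -(4 * (N : ℝ) * Real.log N) / (2 * N) = -Real.log ((N : ℝ) ^ 2) := by
    rw [Real.log_pow]; push_cast; field_simp; ring
  rw [e, Real.exp_neg, Real.exp_log (by positivity), one_div]

lemma gaussianSeq_abs_sum_ge_le {N : ℕ} (hN : 1 ≤ N) :
    gaussianSeq {x | √(4 * N * Real.log N) ≤ |∑ n ∈ Finset.range N, x n|} ≤
      ENNReal.ofReal (2 * (1 / (N : ℝ) ^ 2)) := by
  have h0 : 0 ≤ √(4 * N * Real.log N) := Real.sqrt_nonneg _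
  have h1 := HasSubgaussianMGF.measure_sum_range_ge_le_of_iIndepFun iIndepFun_gaussianSeq (n := N)
    (fun i _ => hasSubgaussianMGF_gaussianSeq i) h0
  have hneg : iIndepFun (fun (n : ℕ) (x : ℕ → ℝ) => -x n) gaussianSeq :=
    iIndepFun_gaussianSeq.comp (fun _ y => -y) (fun _ => measurable_neg)
  have h2 := HasSubgaussianMGF.measure_sum_range_ge_le_of_iIndepFun hneg (n := N)
    (fun i _ => (hasSubgaussianMGF_gaussianSeq i).neg) h0
  simp only [NNReal.coe_one, mul_one, exp_neg_sq_sqrt_log hN] at h1 h2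
  rw [← ofReal_measureReal]
  apply ENNReal.ofReal_le_ofReal
  have hsub : {x : ℕ → ℝ | √(4 * N * Real.log N) ≤ |∑ n ∈ Finset.range N, x n|} ⊆
      {x | √(4 * N * Real.log N) ≤ ∑ n ∈ Finset.range N, x n} ∪
      {x | √(4 * N * Real.log N) ≤ ∑ n ∈ Finset.range N, -x n} := by
    intro x hx
    rcases le_abs.mp (show √(4 * N * Real.log N) ≤ |∑ n ∈ Finset.range N, x n| from hx) with h | h
    · exact Or.inl h
    · right
      simpa [Finset.sum_neg_distrib] using h
  calc _ ≤ _ := measureReal_mono hsub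
    _ ≤ _ := measureReal_union_le _ _
    _ ≤ 2 * (1 / (N : ℝ) ^ 2) := by linarith

/-- Borel–Cantelli gives |∑ x_n| < √(4N log N) for large N, and the logarithm is absorbed by N^{2ε}.
-/
lemma ae_sqrtGrowth : ∀ᵐ x ∂gaussianSeq, SqrtGrowth x := by
  have hsum : Summable fun N : ℕ => 2 * (1 / ((N + 1 : ℕ) : ℝ) ^ 2) :=
    ((summable_nat_add_iff 1).mpr (Real.summable_one_div_nat_pow.mpr one_lt_two)).mul_left 2
  have hBC := ae_eventually_notMem (μ := gaussianSeq) (s := fun N : ℕ =>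
    {x | √(4 * (N + 1 : ℕ) * Real.log (N + 1 : ℕ)) ≤ |∑ n ∈ Finset.range (N + 1), x n|}) (by
      refine ne_top_of_le_ne_top ?_ (ENNReal.tsum_le_tsum fun N =>
        gaussianSeq_abs_sum_ge_le (N := N + 1) (by omega))
      exact hsum.tsum_ofReal_ne_top)
  filter_upwards [hBC] with x hx ε hε
  have hx' : ∀ᶠ N : ℕ in atTop, |∑ n ∈ Finset.range N, x n| < √(4 * N * Real.log N) := by
    obtain ⟨N₀, h⟩ := eventually_atTop.mp hx
    filter_upwards [eventually_ge_atTop (N₀ + 1)] with N hN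
    obtain ⟨m, rfl⟩ : ∃ m, N = m + 1 := ⟨N - 1, by omega⟩
    exact not_le.mp (h m (by omega))
  refine Asymptotics.IsBigO.of_bound (√(4 / (2 * ε))) ?_
  filter_upwards [hx', eventually_ge_atTop 1] with N hN hN1
  have hN' : (0 : ℝ) < N := by exact_mod_cast hN1
  rw [Real.norm_eq_abs, Real.norm_of_nonneg (by positivity)]
  refine hN.le.trans ?_
  rw [Real.sqrt_le_left (by positivity), mul_pow, Real.sq_sqrt (by positivity), ← Real.rpow_natCast,
    ← Real.rpow_mul hN'.le]
  have h1 := Real.log_le_rpow_div hN'.le (show 0 < 2 * ε by positivity)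
  have h2 : (N : ℝ) ^ ((1 / 2 + ε) * (2 : ℕ)) = N * (N : ℝ) ^ (2 * ε) := by
    rw [← Real.rpow_one_add' hN'.le (by positivity)]
    congr 1; push_cast; ring
  rw [h2]
  calc 4 * N * Real.log N ≤ 4 * N * ((N : ℝ) ^ (2 * ε) / (2 * ε)) := by gcongr
    _ = _ := by ring

lemma SqrtGrowth.exists_bound {x : ℕ → ℝ} (hx : SqrtGrowth x) {ε : ℝ} (hε : 0 < ε) :
    ∃ C, 0 < C ∧ ∀ N : ℕ, |∑ n ∈ Finset.range (N + 1), x n| ≤ C * ((N : ℝ) + 1) ^ (1 / 2 + ε) := by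
  obtain ⟨C, hC, h⟩ := Asymptotics.bound_of_isBigO_nat_atTop (hx ε hε)
  refine ⟨C, hC, fun N => ?_⟩
  have h1 : (0 : ℝ) < ((N + 1 : ℕ) : ℝ) ^ (1 / 2 + ε) := by positivity
  have := h (x := N + 1) h1.ne'
  rw [Real.norm_of_nonneg h1.le] at this
  exact_mod_cast this

/-- The terms of the series obtained from `∑ x_n n^{-s}` by partial summation. -/
def abelTerm (x : ℕ → ℝ) (n : ℕ) (s : ℂ) : ℂ :=
  ((∑ k ∈ Finset.range (n + 1), x k : ℝ) : ℂ) *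
    ((((n : ℝ) + 1 : ℝ) : ℂ) ^ (-s) - (((n : ℝ) + 2 : ℝ) : ℂ) ^ (-s))

/-- The sum of the random Dirichlet series, on the half-plane `re s > 1/2`. -/
def dirichletSumC (x : ℕ → ℝ) (s : ℂ) : ℂ := ∑' n, abelTerm x n s

lemma norm_cpow_sub_cpow_le (n : ℕ) {s : ℂ} (hs : 0 < s.re) :
    ‖(((n : ℝ) + 1 : ℝ) : ℂ) ^ (-s) - (((n : ℝ) + 2 : ℝ) : ℂ) ^ (-s)‖ ≤
      ‖s‖ * ((n : ℝ) + 1) ^ (-s.re - 1) := by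
  have h := Convex.norm_image_sub_le_of_norm_hasDerivWithin_le (f := fun t : ℝ => (t : ℂ) ^ (-s))
    (f' := fun t : ℝ => (-s) * (t : ℂ) ^ (-s - 1)) (s := Set.Icc ((n : ℝ) + 1) (n + 2))
    (C := ‖s‖ * ((n : ℝ) + 1) ^ (-s.re - 1)) (x := (n : ℝ) + 2) (y := (n : ℝ) + 1) ?_ ?_
    (convex_Icc _ _) (by constructor <;> linarith) (by constructor <;> linarith)
  · refine h.trans_eq ?_
    norm_num
  · intro t ht
    have ht0 : (0 : ℝ) < t := lt_of_lt_of_le (by positivity) ht.1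
    have hd := (hasDerivAt_id (t : ℂ)).cpow_const (c := -s) (Or.inl (by simpa using ht0))
    have := hd.comp_ofReal
    simp only [id, mul_one] at this
    exact this.hasDerivWithinAt
  · intro t ht
    have ht0 : (0 : ℝ) < t := lt_of_lt_of_le (by positivity) ht.1
    rw [norm_mul, norm_neg, Complex.norm_cpow_eq_rpow_re_of_pos ht0]
    gcongr
    have : (-s - 1).re = -s.re - 1 := by simp
    rw [this]
    exact Real.rpow_le_rpow_of_nonpos (by positivity) ht.1 (by linarith)

/-- The growth exponent 1/2 + ε and the exponent −re s − 1 of the difference of powers add up to at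
most −(1 + ε). This is why re s is kept 2ε away from 1/2. -/
lemma SqrtGrowth.norm_abelTerm_le {x : ℕ → ℝ} {ε C : ℝ}
    (hC : ∀ N : ℕ, |∑ n ∈ Finset.range (N + 1), x n| ≤ C * ((N : ℝ) + 1) ^ (1 / 2 + ε))
    {s : ℂ} (hs : 1 / 2 + 2 * ε ≤ s.re) (hε : 0 < ε) (hC0 : 0 < C) (n : ℕ) :
    ‖abelTerm x n s‖ ≤ C * ‖s‖ * ((n : ℝ) + 1) ^ (-(1 + ε)) := by
  rw [abelTerm, norm_mul, Complex.norm_real, Real.norm_eq_abs]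
  have h1 := norm_cpow_sub_cpow_le n (s := s) (by linarith)
  calc _ ≤ (C * ((n : ℝ) + 1) ^ (1 / 2 + ε)) * (‖s‖ * ((n : ℝ) + 1) ^ (-s.re - 1)) := by
        gcongr
        exact hC n
    _ = C * ‖s‖ * ((n : ℝ) + 1) ^ (1 / 2 + ε + (-s.re - 1)) := by
        rw [Real.rpow_add (by positivity) (1 / 2 + ε) (-s.re - 1)]; ring
    _ ≤ _ := by
        gcongr
        · linarith [show (0:ℝ) ≤ n by positivity]
        · linarith

lemma SqrtGrowth.summable_abelTerm {x : ℕ → ℝ} (hx : SqrtGrowth x) {s : ℂ} (hs : 1 / 2 < s.re) :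
    Summable fun n => abelTerm x n s := by
  obtain ⟨C, hC0, hC⟩ := hx.exists_bound (ε := (s.re - 1 / 2) / 2) (by linarith)
  refine Summable.of_norm_bounded ?_ (SqrtGrowth.norm_abelTerm_le hC (s := s) (by linarith)
    (by linarith) hC0)
  exact (summable_zetaReal (by linarith)).mul_left _

/-- The Abel series converges uniformly on bounded pieces of re s > 1/2 + 2ε, so Weierstrass's
theorem applies near each point. -/
lemma SqrtGrowth.differentiableOn {x : ℕ → ℝ} (hx : SqrtGrowth x) :
    DifferentiableOn ℂ (dirichletSumC x) {s | 1 / 2 < s.re} := by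
  intro s hs
  have hs' : 1 / 2 < s.re := hs
  set ε := (s.re - 1 / 2) / 4 with hε
  have hε0 : 0 < ε := by rw [hε]; linarith
  obtain ⟨C, hC0, hC⟩ := hx.exists_bound hε0
  have hopen : IsOpen {w : ℂ | 1 / 2 + 2 * ε < w.re ∧ ‖w‖ < ‖s‖ + 1} :=
    (isOpen_lt continuous_const Complex.continuous_re).inter
      (isOpen_lt continuous_norm continuous_const)
  have hmem : s ∈ {w : ℂ | 1 / 2 + 2 * ε < w.re ∧ ‖w‖ < ‖s‖ + 1} :=
    ⟨by rw [hε]; linarith, by linarith⟩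
  have hd : DifferentiableOn ℂ (fun w => ∑' n, abelTerm x n w)
      {w : ℂ | 1 / 2 + 2 * ε < w.re ∧ ‖w‖ < ‖s‖ + 1} := by
    refine Complex.differentiableOn_tsum_of_summable_norm
      (u := fun n : ℕ => C * (‖s‖ + 1) * ((n : ℝ) + 1) ^ (-(1 + ε)))
      ((summable_zetaReal (by linarith)).mul_left _) ?_ hopen ?_
    · intro n w _
      refine (DifferentiableAt.mul (differentiableAt_const _) (DifferentiableAt.sub ?_ ?_)).differentiableWithinAt
      · exact (differentiableAt_id.neg).const_cpow (Or.inl (Complex.ofReal_ne_zero.mpr (by positivity)))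
      · exact (differentiableAt_id.neg).const_cpow (Or.inl (Complex.ofReal_ne_zero.mpr (by positivity)))
    · intro n w hw
      refine (SqrtGrowth.norm_abelTerm_le hC hw.1.le hε0 hC0 n).trans ?_
      have := hw.2.le
      gcongr
  exact (hd.differentiableAt (hopen.mem_nhds hmem)).differentiableWithinAt

/-- The sum `F(σ)` of the random Dirichlet series at a real point. -/
def dirichletSum (x : ℕ → ℝ) (σ : ℝ) : ℝ := (dirichletSumC x σ).re

lemma dirichletPartialSum_eq_abel (x : ℕ → ℝ) (σ : ℝ) (N : ℕ) :
    dirichletPartialSum x σ N = (∑ n ∈ Finset.range N, x n) * ((N : ℝ) + 1) ^ (-σ) +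
      ∑ n ∈ Finset.range N, (abelTerm x n σ).re := by
  have hterm : ∀ n, (abelTerm x n σ).re = (∑ k ∈ Finset.range (n + 1), x k) *
      (((n : ℝ) + 1) ^ (-σ) - ((n : ℝ) + 2) ^ (-σ)) := by
    intro n
    rw [abelTerm, ← Complex.ofReal_neg, ← Complex.ofReal_cpow (by positivity),
      ← Complex.ofReal_cpow (by positivity), ← Complex.ofReal_sub, ← Complex.ofReal_mul,
      Complex.ofReal_re]
  induction N with
  | zero => simp [dirichletPartialSum]
  | succ N ih =>
    rw [dirichletPartialSum, Finset.sum_range_succ, Finset.sum_range_succ (fun n => (abelTerm x n σ).re),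
      hterm]
    rw [dirichletPartialSum] at ih
    rw [ih, Finset.sum_range_succ x]
    push_cast
    rw [show (N : ℝ) + 1 + 1 = N + 2 by ring]
    ring

/-- The boundary term of partial summation is O(N^{-ε}). The growth condition does not involve σ, so
one null set serves all σ > 1/2 simultaneously. -/
lemma SqrtGrowth.tendsto_dirichletPartialSum {x : ℕ → ℝ} (hx : SqrtGrowth x) {σ : ℝ}
    (hσ : 1 / 2 < σ) :
    Tendsto (dirichletPartialSum x σ) atTop (𝓝 (dirichletSum x σ)) := by
  have h1 : Tendsto (fun N => ∑ n ∈ Finset.range N, (abelTerm x n σ).re) atTop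
      (𝓝 (dirichletSum x σ)) :=
    (Complex.hasSum_re (hx.summable_abelTerm (s := σ) (by simpa using hσ)).hasSum).tendsto_sum_nat
  have h2 : Tendsto (fun N : ℕ => (∑ n ∈ Finset.range N, x n) * ((N : ℝ) + 1) ^ (-σ)) atTop
      (𝓝 0) := by
    set ε := (σ - 1 / 2) / 2 with hε
    have hε0 : 0 < ε := by rw [hε]; linarith
    have hO := (hx ε hε0).mul (Asymptotics.isBigO_refl (fun N : ℕ => ((N : ℝ) + 1) ^ (-σ)) atTop)
    refine hO.trans_tendsto ?_
    have hz : Tendsto (fun N : ℕ => (N : ℝ) ^ (-ε)) atTop (𝓝 0) :=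
      (tendsto_rpow_neg_atTop hε0).comp tendsto_natCast_atTop_atTop
    refine squeeze_zero' (Eventually.of_forall fun N => by positivity) ?_ hz
    filter_upwards [eventually_ge_atTop 1] with N hN
    have hN' : (0 : ℝ) < N := by exact_mod_cast hN
    calc (N : ℝ) ^ (1 / 2 + ε) * ((N : ℝ) + 1) ^ (-σ) ≤ (N : ℝ) ^ (1 / 2 + ε) * (N : ℝ) ^ (-σ) := by
          refine mul_le_mul_of_nonneg_left ?_ (by positivity)
          exact Real.rpow_le_rpow_of_nonpos hN' (by linarith) (by linarith)
      _ = (N : ℝ) ^ (-ε) := by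
          rw [← Real.rpow_add hN']; congr 1; rw [hε]; ring
  have h3 := h2.add h1
  rw [zero_add] at h3
  exact h3.congr fun N => (dirichletPartialSum_eq_abel x σ N).symm

/-- The derivative of `dirichletSum`. -/
def dirichletSumDeriv (x : ℕ → ℝ) (σ : ℝ) : ℝ := (deriv (dirichletSumC x) σ).re

lemma isOpen_half_lt_re : IsOpen {s : ℂ | 1 / 2 < s.re} :=
  isOpen_lt continuous_const Complex.continuous_re

lemma SqrtGrowth.hasDerivAt {x : ℕ → ℝ} (hx : SqrtGrowth x) {σ : ℝ} (hσ : 1 / 2 < σ) :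
    HasDerivAt (dirichletSum x) (dirichletSumDeriv x σ) σ :=
  ((hx.differentiableOn.differentiableAt (isOpen_half_lt_re.mem_nhds
    (show 1 / 2 < (σ : ℂ).re by simpa using hσ))).hasDerivAt).real_of_complex

/-- The second derivative is continuous, hence bounded on [a, b]. The bound is taken to be a natural
number so that only countably many events arise in the absence of double zeros. -/
lemma SqrtGrowth.exists_taylor_bound {x : ℕ → ℝ} (hx : SqrtGrowth x) {a b : ℝ} (ha : 1 / 2 < a) :
    ∃ M : ℕ, ∀ s ∈ Set.Icc a b, ∀ t ∈ Set.Icc a b,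
      |dirichletSum x s - dirichletSum x t - dirichletSumDeriv x t * (s - t)| ≤ M * (s - t) ^ 2 := by
  have hd1 := hx.differentiableOn.deriv isOpen_half_lt_re
  have hd2 := hd1.deriv isOpen_half_lt_re
  have hmaps : Set.MapsTo (fun t : ℝ => (t : ℂ)) (Set.Icc a b) {s : ℂ | 1 / 2 < s.re} :=
    fun t ht => lt_of_lt_of_le ha (by simpa using ht.1)
  have hF'' : ∀ t ∈ Set.Icc a b, HasDerivAt (dirichletSumDeriv x)
      (deriv (deriv (dirichletSumC x)) t).re t := fun t ht =>
    ((hd1.differentiableAt (isOpen_half_lt_re.mem_nhds (hmaps ht))).hasDerivAt).real_of_complex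
  have hcont : ContinuousOn (fun t : ℝ => (deriv (deriv (dirichletSumC x)) t).re) (Set.Icc a b) :=
    Complex.continuous_re.comp_continuousOn
      (hd2.continuousOn.comp Complex.continuous_ofReal.continuousOn hmaps)
  obtain ⟨C, hC⟩ := isCompact_Icc.exists_bound_of_continuousOn hcont
  obtain ⟨M, hM⟩ := exists_nat_ge C
  refine ⟨M, fun s hs t ht => ?_⟩
  have hsub : Set.uIcc t s ⊆ Set.Icc a b := by
    have hab : a ≤ b := hs.1.trans hs.2
    rw [← Set.uIcc_of_le hab] at *
    exact Set.uIcc_subset_uIcc ht hs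
  have hlip : ∀ r ∈ Set.uIcc t s, |dirichletSumDeriv x r - dirichletSumDeriv x t| ≤ M * |s - t| := by
    intro r hr
    have h := (convex_Icc a b).norm_image_sub_le_of_norm_hasDerivWithin_le
      (fun y hy => (hF'' y hy).hasDerivWithinAt) (fun y hy => (hC y hy).trans hM) ht (hsub hr)
    refine h.trans ?_
    rw [Real.norm_eq_abs]
    refine mul_le_mul_of_nonneg_left ?_ (Nat.cast_nonneg M)
    exact Set.abs_sub_left_of_mem_uIcc hr
  have h := (convex_uIcc t s).norm_image_sub_le_of_norm_hasDerivWithin_le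
    (f := fun y => dirichletSum x y - dirichletSumDeriv x t * y)
    (f' := fun y => dirichletSumDeriv x y - dirichletSumDeriv x t) (C := M * |s - t|)
    (fun y hy => ((hx.hasDerivAt (lt_of_lt_of_le ha (hsub hy).1)).sub
      (by simpa using (hasDerivAt_id y).const_mul (dirichletSumDeriv x t))).hasDerivWithinAt)
    (fun y hy => hlip y hy) Set.left_mem_uIcc Set.right_mem_uIcc
  rw [Real.norm_eq_abs, Real.norm_eq_abs, mul_assoc, ← sq, sq_abs] at h
  convert h using 2
  ring

/-! ### The law of the values of F, and the absence of double zeros -/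

lemma ae_tendsto_dirichletPartialSum {σ : ℝ} (hσ : 1 / 2 < σ) :
    ∀ᵐ x ∂gaussianSeq, Tendsto (dirichletPartialSum x σ) atTop (𝓝 (dirichletSum x σ)) := by
  filter_upwards [ae_sqrtGrowth] with x hx using hx.tendsto_dirichletPartialSum hσ

lemma aemeasurable_dirichletSum {σ : ℝ} (hσ : 1 / 2 < σ) :
    AEMeasurable (fun x => dirichletSum x σ) gaussianSeq := by
  refine aemeasurable_of_tendsto_metrizable_ae atTop (f := fun N x => dirichletPartialSum x σ N)
    (fun N => ?_) (ae_tendsto_dirichletPartialSum hσ)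
  exact (Finset.measurable_fun_sum _ fun n _ =>
    (measurable_pi_apply n).mul_const _).aemeasurable

lemma map_dirichletSum_pair {s t : ℝ} (hs : 1 / 2 < s) (hst : s < t) :
    gaussianSeq.map (fun x => (dirichletSum x s, dirichletSum x t)) =
      gaussianPlane.map fun p => (√(zetaReal (2 * s)) * p.1, √(zetaReal (2 * t)) *
        (Real.cos (Real.arccos (dirichletCorr s t)) * p.1 +
          Real.sin (Real.arccos (dirichletCorr s t)) * p.2)) := by
  have hsum : ∀ u v : ℝ, 1 < u + v →
      HasSum (fun n : ℕ => ((n : ℝ) + 1) ^ (-u) * ((n : ℝ) + 1) ^ (-v)) (zetaReal (u + v)) := by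
    intro u v huv
    refine (summable_zetaReal huv).hasSum.congr_fun fun n => ?_
    rw [← Real.rpow_add (by positivity)]
    congr 1; ring
  have p1 := zetaReal_pos (u := 2 * s) (by linarith)
  have p2 := zetaReal_pos (u := 2 * t) (by linarith)
  have hlim : ∀ u : ℝ, 1 / 2 < u → ∀ᵐ x ∂gaussianSeq,
      Tendsto (fun N => ∑ n ∈ Finset.range N, ((n : ℝ) + 1) ^ (-u) * x n) atTop
        (𝓝 (dirichletSum x u)) := by
    intro u hu
    filter_upwards [ae_tendsto_dirichletPartialSum hu] with x hx
    refine hx.congr fun N => ?_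
    exact Finset.sum_congr rfl fun n _ => mul_comm _ _
  refine map_gaussian_series_eq (c := fun n : ℕ => ((n : ℝ) + 1) ^ (-s))
    (d := fun n : ℕ => ((n : ℝ) + 1) ^ (-t)) ?_ ?_ ?_ (aemeasurable_dirichletSum hs)
    (aemeasurable_dirichletSum (hs.trans hst)) (hlim s hs) (hlim t (hs.trans hst))
  · rw [Real.sq_sqrt p1.le, two_mul]
    simpa [sq] using hsum s s (by linarith)
  · rw [Real.sq_sqrt p2.le, two_mul]
    simpa [sq] using hsum t t (by linarith)
  · rw [Real.cos_arccos (by linarith [dirichletCorr_pos hs (hs.trans hst)])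
      (dirichletCorr_le_one hs hst), ← Real.sqrt_mul p1.le, dirichletCorr,
      mul_div_cancel₀ _ (by positivity)]
    exact hsum s t (by linarith)

lemma gaussianSeq_dirichletSum_mul_neg {s t : ℝ} (hs : 1 / 2 < s) (hst : s < t) :
    gaussianSeq {x | dirichletSum x s * dirichletSum x t < 0} =
      ENNReal.ofReal (Real.arccos (dirichletCorr s t) / Real.pi) := by
  have p1 := Real.sqrt_pos.mpr (zetaReal_pos (u := 2 * s) (by linarith))
  have p2 := Real.sqrt_pos.mpr (zetaReal_pos (u := 2 * t) (by linarith))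
  have hS : MeasurableSet {p : ℝ × ℝ | p.1 * p.2 < 0} :=
    measurableSet_lt (by fun_prop) (by fun_prop)
  have h := congrArg (fun m => m {p : ℝ × ℝ | p.1 * p.2 < 0}) (map_dirichletSum_pair hs hst)
  rw [Measure.map_apply_of_aemeasurable ((aemeasurable_dirichletSum hs).prodMk
    (aemeasurable_dirichletSum (hs.trans hst))) hS, Measure.map_apply (by fun_prop) hS] at h
  rw [← gaussianPlane_mul_neg (Real.arccos_nonneg _)
    (Real.arccos_le_pi_div_two.mpr (dirichletCorr_pos hs (hs.trans hst)).le)]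
  refine h.trans ?_
  congr 1
  ext p
  simp only [Set.mem_preimage, Set.mem_ofPred_eq]
  rw [mul_mul_mul_comm]
  have hpos : 0 < √(zetaReal (2 * s)) * √(zetaReal (2 * t)) := mul_pos p1 p2
  exact ⟨fun h => by by_contra hn; exact absurd h (not_lt.mpr (mul_nonneg hpos.le
      (not_lt.mp hn))), fun h => mul_neg_of_pos_of_neg hpos h⟩

/-- The variance ζ(2σ) is at least 1 and the standard Gaussian density is at most 1, so the bound is
uniform in σ. -/
lemma gaussianSeq_abs_dirichletSum_le {σ : ℝ} (hσ : 1 / 2 < σ) (ε : ℝ) :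
    gaussianSeq {x | |dirichletSum x σ| ≤ ε} ≤ ENNReal.ofReal (2 * ε) := by
  have p1 : 1 ≤ √(zetaReal (2 * σ)) := by
    rw [Real.one_le_sqrt]
    exact one_le_zetaReal (by linarith)
  have hS : MeasurableSet {p : ℝ × ℝ | |p.1| ≤ ε} :=
    measurableSet_le (by fun_prop) (by fun_prop)
  -- The companion point σ + 1 is arbitrary: only the first marginal of the pair matters.
  have h := congrArg (fun m => m {p : ℝ × ℝ | |p.1| ≤ ε})
    (map_dirichletSum_pair hσ (lt_add_one σ))
  rw [Measure.map_apply_of_aemeasurable ((aemeasurable_dirichletSum hσ).prodMk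
    (aemeasurable_dirichletSum (by linarith))) hS, Measure.map_apply (by fun_prop) hS] at h
  refine h.trans_le ?_
  have hsub : (fun p : ℝ × ℝ => (√(zetaReal (2 * σ)) * p.1, √(zetaReal (2 * (σ + 1))) *
        (Real.cos (Real.arccos (dirichletCorr σ (σ + 1))) * p.1 +
          Real.sin (Real.arccos (dirichletCorr σ (σ + 1))) * p.2))) ⁻¹' {p | |p.1| ≤ ε} ⊆
      {y : ℝ | |y| ≤ ε} ×ˢ Set.univ := by
    intro p hp
    refine ⟨?_, trivial⟩
    have hp' : |√(zetaReal (2 * σ)) * p.1| ≤ ε := hp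
    rw [abs_mul, abs_of_nonneg (by positivity)] at hp'
    exact (le_mul_of_one_le_left (abs_nonneg _) p1).trans hp'
  refine (measure_mono hsub).trans ?_
  rw [Measure.prod_prod, measure_univ, mul_one]
  exact gaussianReal_abs_le ε

lemma ae_dirichletSum_ne_zero {σ : ℝ} (hσ : 1 / 2 < σ) :
    ∀ᵐ x ∂gaussianSeq, dirichletSum x σ ≠ 0 := by
  rw [ae_iff]
  simpa using gaussianSeq_abs_dirichletSum_le hσ 0

lemma exists_gridPoint_le_lt {a b t : ℝ} (hab : a < b) (ht : t ∈ Set.Icc a b) (n : ℕ) :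
    -- The index n + 1 occurs only for t = b, and the next grid point then lies beyond b.
    ∃ i ≤ n + 1, gridPoint a b n i ≤ t ∧ t < gridPoint a b n (i + 1) := by
  have hh : 0 < (b - a) / ((n : ℝ) + 1) := div_pos (by linarith) (by positivity)
  refine ⟨⌊(t - a) / ((b - a) / ((n : ℝ) + 1))⌋₊, ?_, ?_, ?_⟩
  · rw [← Nat.cast_le (α := ℝ)]
    refine (Nat.floor_le (div_nonneg (by linarith [ht.1]) hh.le)).trans ?_
    rw [div_le_iff₀ hh]
    push_cast
    rw [mul_div_cancel₀ _ (by positivity)]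
    linarith [ht.2]
  · rw [gridPoint]
    have := Nat.floor_le (div_nonneg (show 0 ≤ t - a by linarith [ht.1]) hh.le)
    rw [le_div_iff₀ hh] at this
    linarith
  · rw [gridPoint]
    have := Nat.lt_floor_add_one ((t - a) / ((b - a) / ((n : ℝ) + 1)))
    rw [div_lt_iff₀ hh] at this
    push_cast
    linarith

/-- Bulinskaya's lemma: almost surely, no point is a double zero. -/
lemma ae_no_double_zero {a b : ℝ} (ha : 1 / 2 < a) (hab : a < b) :
    ∀ᵐ x ∂gaussianSeq, ∀ t ∈ Set.Icc a b, dirichletSum x t = 0 → dirichletSumDeriv x t ≠ 0 := by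
  -- At a double zero t, Taylor's bound gives |F(s)| ≤ M(s−t)² on [a, b], hence |F| ≤ Mh² at a grid
  -- point within h of t. Each of the n + 2 grid points does so with probability at most 2Mh², so
  -- the union has probability at most 4M(b−a)h, which tends to 0.
  have hM : ∀ M : ℕ, ∀ᵐ x ∂gaussianSeq, ¬ ∃ t ∈ Set.Icc a b, ∀ s ∈ Set.Icc a b,
      |dirichletSum x s| ≤ M * (s - t) ^ 2 := by
    intro M
    rw [ae_iff]
    simp only [not_not]
    have hbound : ∀ n : ℕ, gaussianSeq {x | ∃ t ∈ Set.Icc a b, ∀ s ∈ Set.Icc a b,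
        |dirichletSum x s| ≤ M * (s - t) ^ 2} ≤
        ENNReal.ofReal (4 * (M * ((b - a) * ((b - a) / ((n : ℝ) + 1))))) := by
      intro n
      set h := (b - a) / ((n : ℝ) + 1) with hh
      have hh0 : 0 < h := div_pos (by linarith) (by positivity)
      have hsub : {x | ∃ t ∈ Set.Icc a b, ∀ s ∈ Set.Icc a b,
          |dirichletSum x s| ≤ M * (s - t) ^ 2} ⊆
          ⋃ i ∈ Finset.range (n + 2), {x | |dirichletSum x (gridPoint a b n i)| ≤ M * h ^ 2} := by
        rintro x ⟨t, ht, hx⟩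
        obtain ⟨i, hi, h1, h2⟩ := exists_gridPoint_le_lt hab ht n
        simp only [Set.mem_iUnion, Finset.mem_range]
        refine ⟨i, by omega, (hx _ (gridPoint_mem hab.le hi)).trans ?_⟩
        have hd := gridPoint_succ_sub a b n i
        rw [← hh] at hd
        refine mul_le_mul_of_nonneg_left ?_ (Nat.cast_nonneg M)
        nlinarith
      refine (measure_mono hsub).trans ((measure_biUnion_finset_le _ _).trans ?_)
      refine (Finset.sum_le_sum fun i hi => gaussianSeq_abs_dirichletSum_le
        (lt_of_lt_of_le ha (gridPoint_mem hab.le (by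
          have := Finset.mem_range.mp hi; omega)).1) _).trans ?_
      rw [Finset.sum_const, Finset.card_range, nsmul_eq_mul, ← ENNReal.ofReal_natCast,
        ← ENNReal.ofReal_mul (by positivity)]
      apply ENNReal.ofReal_le_ofReal
      have e1 : (b - a) = h * (n + 1) := by rw [hh]; field_simp
      rw [e1]
      push_cast
      have : (0:ℝ) ≤ M * h ^ 2 := by positivity
      have hn : (0:ℝ) ≤ n := by positivity
      nlinarith [mul_nonneg this hn]
    have hlim : Tendsto (fun n : ℕ => ENNReal.ofReal (4 * (M * ((b - a) * ((b - a) / ((n : ℝ) + 1))))))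
        atTop (𝓝 0) := by
      have h := (((tendsto_gridMesh a b).const_mul (b - a)).const_mul (M : ℝ)).const_mul 4
      simp only [mul_zero] at h
      simpa using ENNReal.tendsto_ofReal h
    exact le_antisymm (ge_of_tendsto' hlim hbound) (by simp)
  filter_upwards [ae_all_iff.mpr hM, ae_sqrtGrowth] with x hx hgr t ht h0 h1
  obtain ⟨M, hMx⟩ := hgr.exists_taylor_bound (b := b) ha
  refine hx M ⟨t, ht, fun s hs => ?_⟩
  have := hMx s hs t ht
  rwa [h0, h1, sub_zero, zero_mul, sub_zero] at this

/-! ### Counting zeros by sign changes on a grid -/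

/-- The number of cells of the division of `[a, b]` into `n + 1` equal cells over which `f` changes
sign. -/
def signChanges (f : ℝ → ℝ) (a b : ℝ) (n : ℕ) : ℕ :=
  ((Finset.range (n + 1)).filter fun i =>
    f (gridPoint a b n i) * f (gridPoint a b n (i + 1)) < 0).card

lemma signChanges_le_encard {f : ℝ → ℝ} {a b : ℝ} (hab : a < b)
    (hf : ContinuousOn f (Set.Icc a b)) (n : ℕ) :
    (signChanges f a b n : ℕ∞) ≤ {σ | σ ∈ Set.Icc a b ∧ f σ = 0}.encard := by
  have hz : ∀ i ∈ (Finset.range (n + 1)).filter fun i =>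
      f (gridPoint a b n i) * f (gridPoint a b n (i + 1)) < 0,
      ∃ z, gridPoint a b n i < z ∧ z < gridPoint a b n (i + 1) ∧ f z = 0 := by
    intro i hi
    rw [Finset.mem_filter, Finset.mem_range] at hi
    have hle := gridPoint_mono hab.le n (Nat.le_succ i)
    have hc : ContinuousOn f (Set.Icc (gridPoint a b n i) (gridPoint a b n (i + 1))) :=
      hf.mono (Set.Icc_subset_Icc (gridPoint_mem hab.le (by omega)).1
        (gridPoint_mem hab.le (by omega)).2)
    rcases mul_neg_iff.mp hi.2 with ⟨h1, h2⟩ | ⟨h1, h2⟩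
    · obtain ⟨z, hz, hz0⟩ := intermediate_value_Ioo' hle hc ⟨h2, h1⟩
      exact ⟨z, hz.1, hz.2, hz0⟩
    · obtain ⟨z, hz, hz0⟩ := intermediate_value_Ioo hle hc ⟨h1, h2⟩
      exact ⟨z, hz.1, hz.2, hz0⟩
  choose! z hz1 hz2 hz3 using hz
  set s := (Finset.range (n + 1)).filter fun i =>
      f (gridPoint a b n i) * f (gridPoint a b n (i + 1)) < 0 with hs
  have hlt : ∀ i ∈ s, ∀ j ∈ s, i < j → z i < z j := fun i hi j hj hij =>
    (hz2 i hi).trans_le ((gridPoint_mono hab.le n (Nat.succ_le_of_lt hij)).trans (hz1 j hj).le)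
  have hinj : Set.InjOn z s := by
    intro i hi j hj hij
    rcases lt_trichotomy i j with h | h | h
    · exact absurd hij (hlt i hi j hj h).ne
    · exact h
    · exact absurd hij (hlt j hj i hi h).ne'
  have hcard : (signChanges f a b n : ℕ∞) = (z '' (s : Set ℕ)).encard := by
    rw [hinj.encard_image, Set.encard_coe_eq_coe_finsetCard, signChanges]
  rw [hcard]
  refine Set.encard_le_encard ?_
  rintro _ ⟨i, hi, rfl⟩
  have hi' := hi
  rw [hs, Finset.mem_coe, Finset.mem_filter, Finset.mem_range] at hi'
  exact ⟨⟨(gridPoint_mem hab.le (by omega)).1.trans (hz1 i hi).le,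
    (hz2 i hi).le.trans (gridPoint_mem hab.le (by omega)).2⟩, hz3 i hi⟩

lemma eventually_sign_change {f : ℝ → ℝ} {z d : ℝ} (hf : HasDerivAt f d z) (hd : d ≠ 0)
    (hz : f z = 0) : ∃ η > 0, ∀ s t, s < z → z < t → z - s < η → t - z < η → f s * f t < 0 := by
  have h1 := hasDerivAt_iff_tendsto_slope.mp hf
  -- Multiplying the slope by d avoids distinguishing the sign of the derivative.
  have h2 : ∀ᶠ y in 𝓝[≠] z, 0 < d * slope f z y := by
    have h3 := h1.const_mul d
    exact h3.eventually (lt_mem_nhds (mul_self_pos.mpr hd))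
  rw [eventually_nhdsWithin_iff] at h2
  obtain ⟨η, hη, h⟩ := Metric.eventually_nhds_iff.mp h2
  refine ⟨η, hη, fun s t hs ht hs' ht' => ?_⟩
  have a1 := h (y := s) (by rw [Real.dist_eq, abs_lt]; constructor <;> linarith) hs.ne
  have a2 := h (y := t) (by rw [Real.dist_eq, abs_lt]; constructor <;> linarith) ht.ne'
  rw [slope_def_field, hz, sub_zero] at a1 a2
  have b1 : d * f s < 0 := by
    have e : d * f s = d * (f s / (s - z)) * (s - z) := by
      have : s - z ≠ 0 := by linarith [sub_neg.mpr hs] |> fun h : s - z < 0 => h.ne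
      field_simp
    rw [e]
    exact mul_neg_of_pos_of_neg a1 (by linarith)
  have b2 : 0 < d * f t := by
    have e : d * f t = d * (f t / (t - z)) * (t - z) := by
      have : t - z ≠ 0 := (sub_pos.mpr ht).ne'
      field_simp
    rw [e]
    exact mul_pos a2 (by linarith)
  have b3 : d * d * (f s * f t) < 0 := by
    have := mul_neg_of_neg_of_pos b1 b2
    linarith
  by_contra hn
  exact absurd b3 (not_lt.mpr (mul_nonneg (mul_self_nonneg d) (not_lt.mp hn)))

/-- Once the mesh is smaller than the gaps in `s`, its zeros lie in distinct cells, in their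
interior by `hgrid`; being simple, each makes `f` change sign over its cell when the mesh is small.
-/
lemma eventually_card_le_signChanges {f f' : ℝ → ℝ} {a b : ℝ} (hab : a < b)
    (hd : ∀ z ∈ Set.Icc a b, f z = 0 → HasDerivAt f (f' z) z ∧ f' z ≠ 0)
    (hgrid : ∀ n i, i ≤ n + 1 → f (gridPoint a b n i) ≠ 0)
    (s : Finset ℝ) (hs : ∀ z ∈ s, z ∈ Set.Icc a b ∧ f z = 0) :
    ∀ᶠ n in atTop, s.card ≤ signChanges f a b n := by
  have hmesh := tendsto_gridMesh a b
  have ev1 : ∀ᶠ n : ℕ in atTop, ∀ z ∈ s, ∀ i, i ≤ n → gridPoint a b n i < z →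
      z < gridPoint a b n (i + 1) → f (gridPoint a b n i) * f (gridPoint a b n (i + 1)) < 0 := by
    rw [Filter.eventually_all_finset]
    intro z hz
    obtain ⟨hz1, hz0⟩ := hs z hz
    obtain ⟨hder, hne⟩ := hd z hz1 hz0
    obtain ⟨η, hη, h⟩ := eventually_sign_change hder hne hz0
    filter_upwards [hmesh.eventually (gt_mem_nhds hη)] with n hn i _ h1 h2
    have hstep := gridPoint_succ_sub a b n i
    exact h _ _ h1 h2 (by linarith) (by linarith)
  have ev2 : ∀ᶠ n : ℕ in atTop, ∀ z ∈ s, ∀ w ∈ s, z ≠ w → (b - a) / ((n : ℝ) + 1) < |z - w| := by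
    rw [Filter.eventually_all_finset]
    intro z _
    rw [Filter.eventually_all_finset]
    intro w _
    by_cases h : z = w
    · exact Eventually.of_forall fun n hn => absurd h hn
    · filter_upwards [hmesh.eventually (gt_mem_nhds (abs_pos.mpr (sub_ne_zero.mpr h)))] with n hn _
      exact hn
  filter_upwards [ev1, ev2] with n h1 h2
  have hcell : ∀ z ∈ s, ∃ i ≤ n, gridPoint a b n i < z ∧ z < gridPoint a b n (i + 1) := by
    intro z hz
    obtain ⟨hz1, hz0⟩ := hs z hz
    obtain ⟨i, hi, hiz, hzi⟩ := exists_gridPoint_le_lt hab hz1 n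
    have hlt : gridPoint a b n i < z := lt_of_le_of_ne hiz fun h => hgrid n i hi (h ▸ hz0)
    refine ⟨i, ?_, hlt, hzi⟩
    by_contra hn
    have : i = n + 1 := by omega
    rw [this, gridPoint_last] at hlt
    exact absurd hz1.2 (not_le.mpr hlt)
  choose! c hc1 hc2 hc3 using hcell
  refine Finset.card_le_card_of_injOn c (fun z hz => ?_) ?_
  · simp only [Finset.coe_filter, Finset.mem_range, Set.mem_ofPred_eq]
    have hz' : z ∈ s := hz
    exact ⟨by have := hc1 z hz'; omega, h1 z hz' (c z) (hc1 z hz') (hc2 z hz') (hc3 z hz')⟩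
  · intro z hz w hw hzw
    by_contra hne
    have hgap := h2 z hz w hw hne
    have hstep := gridPoint_succ_sub a b n (c z)
    have a1 := hc2 z hz
    have a2 := hc3 z hz
    have a3 := hc2 w hw
    have a4 := hc3 w hw
    rw [← hzw] at a3 a4
    have : |z - w| < (b - a) / ((n : ℝ) + 1) := by
      rw [abs_lt]; constructor <;> linarith
    linarith

/-- Testing against finite subsets avoids assuming that there are finitely many zeros: an infinite
set would force the lower limit to be infinite. -/
lemma encard_le_liminf_signChanges {f f' : ℝ → ℝ} {a b : ℝ} (hab : a < b)
    (hd : ∀ z ∈ Set.Icc a b, f z = 0 → HasDerivAt f (f' z) z ∧ f' z ≠ 0)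
    (hgrid : ∀ n i, i ≤ n + 1 → f (gridPoint a b n i) ≠ 0) :
    (({σ | σ ∈ Set.Icc a b ∧ f σ = 0}.encard : ℕ∞) : ENNReal) ≤
      liminf (fun n => (signChanges f a b n : ENNReal)) atTop := by
  have hfin : ∀ s : Finset ℝ, (↑s : Set ℝ) ⊆ {σ | σ ∈ Set.Icc a b ∧ f σ = 0} →
      (s.card : ENNReal) ≤ liminf (fun n => (signChanges f a b n : ENNReal)) atTop := by
    intro s hs
    refine le_liminf_of_le (by isBoundedDefault) ?_
    filter_upwards [eventually_card_le_signChanges hab hd hgrid s fun z hz => hs hz] with n hn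
    exact_mod_cast hn
  rcases Set.finite_or_infinite {σ | σ ∈ Set.Icc a b ∧ f σ = 0} with h | h
  · rw [h.encard_eq_coe_toFinset_card]
    have := hfin h.toFinset (by simp)
    simpa using this
  · rw [h.encard_eq, ENat.toENNReal_top, top_le_iff]
    refine ENNReal.eq_top_of_forall_nnreal_le fun r => ?_
    obtain ⟨k, hk⟩ := exists_nat_ge r
    obtain ⟨s, hs, hcard⟩ := h.exists_subset_card_eq k
    refine le_trans ?_ (hfin s hs)
    rw [hcard]
    exact_mod_cast hk

lemma nullMeasurableSet_mul_neg {s t : ℝ} (hs : 1 / 2 < s) (ht : 1 / 2 < t) :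
    NullMeasurableSet {x | dirichletSum x s * dirichletSum x t < 0} gaussianSeq :=
  nullMeasurableSet_lt ((aemeasurable_dirichletSum hs).mul (aemeasurable_dirichletSum ht))
    aemeasurable_const

lemma signChanges_eq_sum_indicator (a b : ℝ) (n : ℕ) (x : ℕ → ℝ) :
    (signChanges (dirichletSum x) a b n : ENNReal) = ∑ i ∈ Finset.range (n + 1),
      {x | dirichletSum x (gridPoint a b n i) * dirichletSum x (gridPoint a b n (i + 1)) < 0}.indicator
        1 x := by
  rw [signChanges, Finset.card_filter, Nat.cast_sum]
  refine Finset.sum_congr rfl fun i _ => ?_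
  simp [Set.indicator_apply]

lemma aemeasurable_signChanges {a b : ℝ} (ha : 1 / 2 < a) (hab : a < b) (n : ℕ) :
    AEMeasurable (fun x => (signChanges (dirichletSum x) a b n : ENNReal)) gaussianSeq := by
  simp_rw [signChanges_eq_sum_indicator]
  refine Finset.aemeasurable_fun_sum _ fun i hi => ?_
  have hi' := Finset.mem_range.mp hi
  exact (aemeasurable_one.indicator₀ (nullMeasurableSet_mul_neg
    (lt_of_lt_of_le ha (gridPoint_mem hab.le (by omega)).1)
    (lt_of_lt_of_le ha (gridPoint_mem hab.le (by omega)).1)))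

lemma lintegral_signChanges {a b : ℝ} (ha : 1 / 2 < a) (hab : a < b) (n : ℕ) :
    ∫⁻ x, (signChanges (dirichletSum x) a b n : ENNReal) ∂gaussianSeq =
      ENNReal.ofReal ((∑ i ∈ Finset.range (n + 1),
        Real.arccos (dirichletCorr (gridPoint a b n i) (gridPoint a b n (i + 1)))) / Real.pi) := by
  have hmem : ∀ i, i ≤ n + 1 → 1 / 2 < gridPoint a b n i := fun i hi =>
    lt_of_lt_of_le ha (gridPoint_mem hab.le hi).1
  simp_rw [signChanges_eq_sum_indicator]
  rw [lintegral_finsetSum' _ fun i hi => ?_, Finset.sum_div,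
    ENNReal.ofReal_sum_of_nonneg fun i _ => div_nonneg (Real.arccos_nonneg _) Real.pi_pos.le]
  · refine Finset.sum_congr rfl fun i hi => ?_
    have hi' := Finset.mem_range.mp hi
    rw [lintegral_indicator_one₀ (nullMeasurableSet_mul_neg (hmem i (by omega))
      (hmem (i + 1) (by omega))), gaussianSeq_dirichletSum_mul_neg (hmem i (by omega))]
    have := gridPoint_succ_sub a b n i
    have : 0 < (b - a) / ((n : ℝ) + 1) := div_pos (by linarith) (by positivity)
    linarith
  · have hi' := Finset.mem_range.mp hi
    exact (aemeasurable_one.indicator₀ (nullMeasurableSet_mul_neg (hmem i (by omega))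
      (hmem (i + 1) (by omega))))

/-! ### The Kac–Rice formula -/

/-- The zeros of the random series in `[a, b]`. -/
def zerosIcc (x : ℕ → ℝ) (a b : ℝ) : Set ℝ := {σ | σ ∈ Set.Icc a b ∧ dirichletSum x σ = 0}

lemma ae_encard_zerosIcc {a b : ℝ} (ha : 1 / 2 < a) (hab : a < b) :
    ∀ᵐ x ∂gaussianSeq,
      (∀ n, (signChanges (dirichletSum x) a b n : ENNReal) ≤ ((zerosIcc x a b).encard : ENNReal)) ∧
      ((zerosIcc x a b).encard : ENNReal) ≤
        liminf (fun n => (signChanges (dirichletSum x) a b n : ENNReal)) atTop := by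
  have hgrid : ∀ᵐ x ∂gaussianSeq, ∀ n i, i ≤ n + 1 → dirichletSum x (gridPoint a b n i) ≠ 0 := by
    rw [ae_all_iff]; intro n
    rw [ae_all_iff]; intro i
    by_cases hi : i ≤ n + 1
    · filter_upwards [ae_dirichletSum_ne_zero (lt_of_lt_of_le ha (gridPoint_mem hab.le hi).1)]
        with x hx _ using hx
    · exact ae_of_all _ fun x h => absurd h hi
  filter_upwards [hgrid, ae_no_double_zero ha hab, ae_sqrtGrowth] with x h1 h2 h3
  have hder : ∀ z ∈ Set.Icc a b, HasDerivAt (dirichletSum x) (dirichletSumDeriv x z) z :=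
    fun z hz => h3.hasDerivAt (lt_of_lt_of_le ha hz.1)
  constructor
  · intro n
    have := signChanges_le_encard hab
      (fun z hz => (hder z hz).continuousAt.continuousWithinAt) n
    exact_mod_cast ENat.toENNReal_le.mpr this
  · exact encard_le_liminf_signChanges hab (fun z hz h0 => ⟨hder z hz, h2 z hz h0⟩) h1

/-- The two bounds on the zero count squeeze it: almost surely it equals the lower limit of the
sign-change counts, which are measurable up to null sets. -/
lemma aemeasurable_encard_zerosIcc {a b : ℝ} (ha : 1 / 2 < a) (hab : a < b) :
    AEMeasurable (fun x => ((zerosIcc x a b).encard : ENNReal)) gaussianSeq := by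
  have h : AEMeasurable (fun x => liminf (fun n =>
      (signChanges (dirichletSum x) a b n : ENNReal)) atTop) gaussianSeq := by
    simp_rw [liminf_eq_iSup_iInf_of_nat']
    exact AEMeasurable.iSup fun n => AEMeasurable.iInf fun i => aemeasurable_signChanges ha hab _
  refine h.congr ?_
  filter_upwards [ae_encard_zerosIcc ha hab] with x hx
  refine le_antisymm ?_ hx.2
  exact liminf_le_of_le (by isBoundedDefault) fun c hc => by
    obtain ⟨n, hn⟩ := hc.exists
    exact hn.trans (hx.1 n)

/-- The expected numbers of sign changes are the Riemann sums divided by π. Fatou's lemma bounds the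
expected zero count above by their limit, and sign changes ≤ zeros bounds it below. -/
lemma lintegral_encard_zerosIcc {a b : ℝ} (ha : 1 / 2 < a) (hab : a < b) :
    ∫⁻ x, ((zerosIcc x a b).encard : ENNReal) ∂gaussianSeq =
      ENNReal.ofReal ((∫ σ in a..b, zeroSpeed σ) / Real.pi) := by
  have hlim : Tendsto (fun n => ∫⁻ x, (signChanges (dirichletSum x) a b n : ENNReal) ∂gaussianSeq)
      atTop (𝓝 (ENNReal.ofReal ((∫ σ in a..b, zeroSpeed σ) / Real.pi))) := by
    simp_rw [lintegral_signChanges ha hab]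
    exact ENNReal.tendsto_ofReal ((tendsto_sum_arccos_dirichletCorr ha hab).div_const _)
  apply le_antisymm
  · calc _ ≤ ∫⁻ x, liminf (fun n => (signChanges (dirichletSum x) a b n : ENNReal)) atTop
          ∂gaussianSeq := lintegral_mono_ae <| by
            filter_upwards [ae_encard_zerosIcc ha hab] with x hx using hx.2
      _ ≤ _ := lintegral_liminf_le' fun n => aemeasurable_signChanges ha hab n
      _ = _ := hlim.liminf_eq
  · refine le_of_tendsto' hlim fun n => lintegral_mono_ae ?_
    filter_upwards [ae_encard_zerosIcc ha hab] with x hx using hx.1 n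

/-- This is continuity from below of the counting measure, all sets being made measurable. -/
lemma encard_iUnion_of_monotone {α : Type*} {A : ℕ → Set α} (hA : Monotone A) :
    ((⋃ n, A n).encard : ENNReal) = ⨆ n, ((A n).encard : ENNReal) := by
  let _ : MeasurableSpace α := ⊤
  have h := hA.measure_iUnion (μ := Measure.count)
  simpa only [Measure.count_apply MeasurableSpace.measurableSet_top] using h

lemma SqrtGrowth.realZerosFrom_eq {x : ℕ → ℝ} (hx : SqrtGrowth x) {T : ℝ} (hT : 1 / 2 < T) :
    realZerosFrom x T = ⋃ m : ℕ, zerosIcc x T (T + (m + 1)) := by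
  ext σ
  simp only [realZerosFrom, zerosIcc, Set.mem_ofPred_eq, Set.mem_iUnion, Set.mem_Icc]
  constructor
  · rintro ⟨h1, h2⟩
    obtain ⟨m, hm⟩ := exists_nat_ge (σ - T)
    exact ⟨m, ⟨h1, by linarith⟩,
      tendsto_nhds_unique (hx.tendsto_dirichletPartialSum (by linarith)) h2⟩
  · rintro ⟨m, ⟨h1, -⟩, h2⟩
    refine ⟨h1, ?_⟩
    rw [← h2]
    exact hx.tendsto_dirichletPartialSum (by linarith)

lemma ae_encard_realZerosFrom {T : ℝ} (hT : 1 / 2 < T) :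
    ∀ᵐ x ∂gaussianSeq, ((realZerosFrom x T).encard : ENNReal) =
      ⨆ m : ℕ, ((zerosIcc x T (T + (m + 1))).encard : ENNReal) := by
  filter_upwards [ae_sqrtGrowth] with x hx
  rw [hx.realZerosFrom_eq hT, encard_iUnion_of_monotone]
  intro m k hmk σ hσ
  refine ⟨⟨hσ.1.1, hσ.1.2.trans ?_⟩, hσ.2⟩
  gcongr

lemma aemeasurable_encard_realZerosFrom {T : ℝ} (hT : 1 / 2 < T) :
    AEMeasurable (fun x => ((realZerosFrom x T).encard : ENNReal)) gaussianSeq := by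
  have h : AEMeasurable (fun x => ⨆ m : ℕ, ((zerosIcc x T (T + (m + 1))).encard : ENNReal))
      gaussianSeq := AEMeasurable.iSup fun m => aemeasurable_encard_zerosIcc hT
        (by linarith [show (0:ℝ) ≤ m by positivity])
  refine h.congr ?_
  filter_upwards [ae_encard_realZerosFrom hT] with x hx using hx.symm

/-- The Kac-Rice formula for the random Dirichlet series. -/
lemma lintegral_encard_realZerosFrom {T : ℝ} (hT : 1 / 2 < T) :
    ∫⁻ x, ((realZerosFrom x T).encard : ENNReal) ∂gaussianSeq =
      ENNReal.ofReal ((∫ σ in Set.Ioi T, zeroSpeed σ) / Real.pi) := by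
  have hlt : ∀ m : ℕ, T < T + (m + 1) := fun m => by linarith [show (0:ℝ) ≤ m by positivity]
  have hmono : ∀ x : ℕ → ℝ, Monotone fun m : ℕ =>
      ((zerosIcc x T (T + (m + 1))).encard : ENNReal) := by
    intro x m k hmk
    refine ENat.toENNReal_le.mpr (Set.encard_le_encard fun σ hσ => ⟨⟨hσ.1.1, hσ.1.2.trans ?_⟩, hσ.2⟩)
    gcongr
  rw [lintegral_congr_ae (ae_encard_realZerosFrom hT), lintegral_iSup'
    (fun m => aemeasurable_encard_zerosIcc hT (hlt m)) (ae_of_all _ hmono)]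
  have h1 : Tendsto (fun m : ℕ => ∫⁻ x, ((zerosIcc x T (T + (m + 1))).encard : ENNReal)
      ∂gaussianSeq) atTop (𝓝 (⨆ m : ℕ, ∫⁻ x, ((zerosIcc x T (T + (m + 1))).encard : ENNReal)
        ∂gaussianSeq)) :=
    tendsto_atTop_iSup fun m k hmk => lintegral_mono fun x => hmono x hmk
  refine tendsto_nhds_unique h1 ?_
  simp_rw [fun m : ℕ => lintegral_encard_zerosIcc hT (hlt m)]
  refine ENNReal.tendsto_ofReal (Tendsto.div_const ?_ _)
  refine intervalIntegral_tendsto_integral_Ioi T (integrableOn_zeroSpeed hT) ?_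
  exact tendsto_atTop_add_const_left _ _
    (tendsto_atTop_add_const_right _ _ tendsto_natCast_atTop_atTop)

/-! ### Transfer to an arbitrary probability space -/

/-- The zero count depends on the coefficient sequence alone, whose law is this fixed product
measure; hence the constants are absolute. -/
lemma map_eq_gaussianSeq {Ω : Type*} [MeasurableSpace Ω] {μ : Measure Ω} {X : ℕ → Ω → ℝ}
    (hX : ∀ n, HasLaw (X n) (gaussianReal 0 1) μ) (hind : iIndepFun X μ) :
    μ.map (fun ω n => X n ω) = gaussianSeq := by
  rw [hind.map_fun_eq_infinitePi_map₀' fun n => (hX n).aemeasurable]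
  simp_rw [(hX _).map_eq]

lemma aemeasurable_zeroCount {Ω : Type*} [MeasurableSpace Ω] {μ : Measure Ω} {X : ℕ → Ω → ℝ}
    (hX : ∀ n, HasLaw (X n) (gaussianReal 0 1) μ) (hind : iIndepFun X μ) {T : ℝ} (hT : 1 / 2 < T) :
    AEMeasurable (zeroCount X T) μ := by
  have h := aemeasurable_encard_realZerosFrom hT
  rw [← map_eq_gaussianSeq hX hind] at h
  exact h.comp_aemeasurable (aemeasurable_pi_iff.mpr fun n => (hX n).aemeasurable)

lemma lintegral_zeroCount {Ω : Type*} [MeasurableSpace Ω] {μ : Measure Ω} {X : ℕ → Ω → ℝ}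
    (hX : ∀ n, HasLaw (X n) (gaussianReal 0 1) μ) (hind : iIndepFun X μ) {T : ℝ} (hT : 1 / 2 < T) :
    ∫⁻ ω, zeroCount X T ω ∂μ = ENNReal.ofReal ((∫ σ in Set.Ioi T, zeroSpeed σ) / Real.pi) := by
  have h := aemeasurable_encard_realZerosFrom hT
  rw [← lintegral_encard_realZerosFrom hT]
  rw [← map_eq_gaussianSeq hX hind] at h ⊢
  rw [lintegral_map' h (aemeasurable_pi_iff.mpr fun n => (hX n).aemeasurable)]
  rfl

end

theorem theorem1 :
    ∃ (δ : ℝ) (c₀ : ℝ) (c : ℕ → ℝ), 0 < δ ∧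
      ∀ {Ω : Type*} [MeasurableSpace Ω] (μ : Measure Ω) [IsProbabilityMeasure μ]
        (X : ℕ → Ω → ℝ),
        (∀ n, HasLaw (X n) (gaussianReal 0 1) μ) → iIndepFun X μ →
        ∀ T ∈ Set.Ioo (1 / 2 : ℝ) (1 / 2 + δ),
          AEMeasurable (zeroCount X T) μ ∧
          ∫⁻ ω, zeroCount X T ω ∂μ ≠ ⊤ ∧
          Summable (fun n : ℕ => c (n + 2) * (T - 1 / 2) ^ (n + 2)) ∧
          (∫⁻ ω, zeroCount X T ω ∂μ).toReal =
            1 / (2 * Real.pi) * Real.log (1 / (T - 1 / 2)) + c₀ +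
              ∑' n : ℕ, c (n + 2) * (T - 1 / 2) ^ (n + 2) := by
  obtain ⟨δ, c₀, c, hδ, h⟩ := exists_integral_zeroSpeed_expansion
  refine ⟨δ, c₀ / Real.pi, fun n => c n / Real.pi, hδ, ?_⟩
  intro Ω _ μ _ X hX hind T hT
  obtain ⟨hsum, hint⟩ := h T hT
  have hterm : (fun n : ℕ => c (n + 2) / Real.pi * (T - 1 / 2) ^ (n + 2)) =
      fun n : ℕ => c (n + 2) * (T - 1 / 2) ^ (n + 2) / Real.pi := by
    ext n; ring
  refine ⟨aemeasurable_zeroCount hX hind hT.1, ?_, ?_, ?_⟩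
  · rw [lintegral_zeroCount hX hind hT.1]
    exact ENNReal.ofReal_ne_top
  · simp only [hterm]
    exact hsum.div_const _
  · rw [lintegral_zeroCount hX hind hT.1, ENNReal.toReal_ofReal (div_nonneg
      (setIntegral_nonneg measurableSet_Ioi fun σ _ => zeroSpeed_nonneg σ) Real.pi_pos.le), hint]
    simp only [hterm]
    rw [tsum_div_const]
    field_simp
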